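/- Let $M$ be a connected, simply connected smooth manifold (finite-dimensional, Hausdorff, second countable, without boundary), and let $\tau$ be a nowhere vanishing smooth one-form on $M$. Put $D = \ker\tau \subseteq TM$ and assume that the restriction of $d\tau$ to $\bigwedge^2 D$ is nonzero at every point of $M$. Let $Z$ be a smooth vector field on $M$ and let $\chi$ be a smooth section of $\bigwedge^2 D$ such that $$\tau(Z) = 1, \qquad d\tau(\chi) = -1,$$ where a two-form $\eta$ is evaluated on two-vectors by $\eta(X\wedge Y) = \eta(X,Y)$ and $d$ is normalized by $d\alpha(X,Y) = X(\alpha(Y)) - Y(\alpha(X)) - \alpha([X,Y])$. For a two-form $\eta$ let $\iota_{\tau\otimes\chi}\eta$ be the one-form $v \mapsto \tau(v)\,\eta(\chi)$, and define the operator $$d_{\tau\otimes\chi} = d\,(\mathrm{id} + \iota_{\tau\otimes\chi}\, d)$$ from one-forms to two-forms. Then there exists a smooth Riemannian metric $g$ on $M$ such that 1. the foliation of $M$ tangent to $Z$ is totally geodesic, that is, every geodesic of a leaf with its induced metric is a geodesic of $(M,g)$, and 2. $D$ is $g$-orthogonal to the line bundle $V = \mathrm{span}\{Z\}$, if and only if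 $$d_{\tau\otimes\chi}\,\mathcal{L}_Z\tau = 0,$$ where $\mathcal{L}_Z\tau$ is the Lie derivative of $\tau$ along $Z$. -/

import Mathlib

open scoped Manifold ContDiff Topology Bundle

noncomputable section

namespace ZFoliation

/-!
Conventions. `M` is a smooth manifold modelled on a finite-dimensional real normed space `E`
(so without boundary). A one-form is a family of continuous linear functionals on the tangent
spaces, a vector field is a family of tangent vectors; smoothness is stated separately.
-/

variable {E : Type*} [NormedAddCommGroup E] [NormedSpace ℝ E]
  {M : Type*} [TopologicalSpace M] [ChartedSpace E M]

/-- Smooth one-forms: smooth sections of the cotangent bundle. -/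
def IsSmoothOneForm [IsManifold 𝓘(ℝ, E) ∞ M]
    (α : Π x : M, TangentSpace 𝓘(ℝ, E) x →L[ℝ] ℝ) : Prop :=
  ContMDiff 𝓘(ℝ, E) (𝓘(ℝ, E).prod 𝓘(ℝ, E →L[ℝ] ℝ)) ∞
    (fun x ↦ Bundle.TotalSpace.mk' (E →L[ℝ] ℝ)
      (E := fun x : M ↦ TangentSpace 𝓘(ℝ, E) x →L[ℝ] ℝ) x (α x))

/-- Vector fields that are smooth on a set: smooth sections of the tangent bundle. -/
def IsSmoothVectorFieldOn [IsManifold 𝓘(ℝ, E) ∞ M]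
    (X : Π x : M, TangentSpace 𝓘(ℝ, E) x) (U : Set M) : Prop :=
  ContMDiffOn 𝓘(ℝ, E) 𝓘(ℝ, E).tangent ∞
    (fun x ↦ (Bundle.TotalSpace.mk' E x (X x) : TangentBundle 𝓘(ℝ, E) M)) U

/-- Smooth vector fields on all of `M`. -/
def IsSmoothVectorField [IsManifold 𝓘(ℝ, E) ∞ M]
    (X : Π x : M, TangentSpace 𝓘(ℝ, E) x) : Prop :=
  IsSmoothVectorFieldOn X Set.univ

/-- Smooth sections of `⋀² D`, for a subbundle `D` of the tangent bundle: two-vector fields which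
are locally finite sums of products `X ∧ Y` of smooth vector fields with values in `D`. -/
def IsSmoothBivectorField [IsManifold 𝓘(ℝ, E) ∞ M]
    (D : Π x : M, Submodule ℝ (TangentSpace 𝓘(ℝ, E) x))
    (χ : Π x : M, ⋀[ℝ]^2 (TangentSpace 𝓘(ℝ, E) x)) : Prop :=
  ∀ x₀ : M, ∃ U : Set M, IsOpen U ∧ x₀ ∈ U ∧
    ∃ (k : ℕ) (X Y : Fin k → Π x : M, TangentSpace 𝓘(ℝ, E) x),
      (∀ i, IsSmoothVectorFieldOn (X i) U ∧ IsSmoothVectorFieldOn (Y i) U) ∧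
      (∀ i, ∀ x ∈ U, X i x ∈ D x ∧ Y i x ∈ D x) ∧
      ∀ x ∈ U, χ x = ∑ i, exteriorPower.ιMulti ℝ 2 ![X i x, Y i x]

/-- The one-form `α` in the chart at `x`: its pullback by the inverse of the chart. -/
def oneFormInChart (α : Π x : M, TangentSpace 𝓘(ℝ, E) x →L[ℝ] ℝ) (x : M) (y : E) :
    E →L[ℝ] ℝ :=
  (α ((extChartAt 𝓘(ℝ, E) x).symm y)).comp
    (mfderiv 𝓘(ℝ, E) 𝓘(ℝ, E) (extChartAt 𝓘(ℝ, E) x).symm y)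

/-- The vector field `X` in the chart at `x`. -/
def vectorFieldInChart (X : Π x : M, TangentSpace 𝓘(ℝ, E) x) (x : M) (y : E) : E :=
  VectorField.mpullback 𝓘(ℝ, E) 𝓘(ℝ, E) (extChartAt 𝓘(ℝ, E) x).symm X y

/-- The exterior derivative `dα` of a one-form, computed at `x` in the chart at `x`. The
normalization is `dα(X, Y) = X(α(Y)) - Y(α(X)) - α([X, Y])`. -/
def extD (α : Π x : M, TangentSpace 𝓘(ℝ, E) x →L[ℝ] ℝ) (x : M) :
    (TangentSpace 𝓘(ℝ, E) x) [⋀^Fin 2]→L[ℝ] ℝ :=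
  (extDeriv (fun y : E ↦ ContinuousAlternatingMap.ofSubsingleton ℝ E ℝ (0 : Fin 1)
      (oneFormInChart α x y)) (extChartAt 𝓘(ℝ, E) x x)).compContinuousLinearMap
    (mfderiv 𝓘(ℝ, E) 𝓘(ℝ, E) (extChartAt 𝓘(ℝ, E) x) x)

/-- The Lie derivative `L_Z α` of a one-form, computed at `x` in the chart at `x`: in coordinates,
`(L_Z α)_j = Z^i ∂_i α_j + α_i ∂_j Z^i`. -/
def lieDerivOneForm (Z : Π x : M, TangentSpace 𝓘(ℝ, E) x)
    (α : Π x : M, TangentSpace 𝓘(ℝ, E) x →L[ℝ] ℝ) (x : M) :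
    TangentSpace 𝓘(ℝ, E) x →L[ℝ] ℝ :=
  (fderiv ℝ (oneFormInChart α x) (extChartAt 𝓘(ℝ, E) x x)
        (vectorFieldInChart Z x (extChartAt 𝓘(ℝ, E) x x)) +
      (oneFormInChart α x (extChartAt 𝓘(ℝ, E) x x)).comp
        (fderiv ℝ (vectorFieldInChart Z x) (extChartAt 𝓘(ℝ, E) x x))).comp
    (mfderiv 𝓘(ℝ, E) 𝓘(ℝ, E) (extChartAt 𝓘(ℝ, E) x) x)

/-- The value `η(ξ)` of an alternating two-form `η` on a two-vector `ξ`; it is determined by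
`η(v ∧ w) = η(v, w)`. -/
def evalBivector {F : Type*} [AddCommGroup F] [Module ℝ F] [TopologicalSpace F]
    (η : F [⋀^Fin 2]→L[ℝ] ℝ) (ξ : ⋀[ℝ]^2 F) : ℝ :=
  exteriorPower.alternatingMapLinearEquiv η.toAlternatingMap ξ

/-- The contraction `ι_{τ ⊗ χ}` from two-forms to one-forms:
`(ι_{τ ⊗ χ} η)(v) = η((τ ⊗ χ)(v)) = τ(v) η(χ)`. -/
def contraction (τ : Π x : M, TangentSpace 𝓘(ℝ, E) x →L[ℝ] ℝ)
    (χ : Π x : M, ⋀[ℝ]^2 (TangentSpace 𝓘(ℝ, E) x))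
    (η : Π x : M, (TangentSpace 𝓘(ℝ, E) x) [⋀^Fin 2]→L[ℝ] ℝ) (x : M) :
    TangentSpace 𝓘(ℝ, E) x →L[ℝ] ℝ :=
  evalBivector (η x) (χ x) • τ x

/-- The operator `d_{τ ⊗ χ} = d (id + ι_{τ ⊗ χ} d)` on one-forms. -/
def dSelector (τ : Π x : M, TangentSpace 𝓘(ℝ, E) x →L[ℝ] ℝ)
    (χ : Π x : M, ⋀[ℝ]^2 (TangentSpace 𝓘(ℝ, E) x))
    (β : Π x : M, TangentSpace 𝓘(ℝ, E) x →L[ℝ] ℝ) (x : M) :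
    (TangentSpace 𝓘(ℝ, E) x) [⋀^Fin 2]→L[ℝ] ℝ :=
  extD (fun p ↦ β p + contraction τ χ (extD β) p) x

/-- The kernel of a one-form. -/
def kerForm (τ : Π x : M, TangentSpace 𝓘(ℝ, E) x →L[ℝ] ℝ) (x : M) :
    Submodule ℝ (TangentSpace 𝓘(ℝ, E) x) :=
  LinearMap.ker (τ x).toLinearMap

/-- The pullback `(u, v) ↦ b (A u) (A v)` of a bilinear form `b` by a linear map `A`. -/
def pullbackBilin {F G : Type*} [AddCommGroup F] [Module ℝ F] [TopologicalSpace F]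
    [AddCommGroup G] [Module ℝ G] [TopologicalSpace G] (b : G →L[ℝ] G →L[ℝ] ℝ) (A : F →L[ℝ] G) :
    F →L[ℝ] F →L[ℝ] ℝ :=
  (ContinuousLinearMap.precomp ℝ A).comp (b.comp A)

/-- The metric tensor `g` in the chart at `x`: its pullback by the inverse of the chart. -/
def metricInChart (g : Π x : M, TangentSpace 𝓘(ℝ, E) x →L[ℝ] TangentSpace 𝓘(ℝ, E) x →L[ℝ] ℝ)
    (x : M) (y : E) : E →L[ℝ] E →L[ℝ] ℝ :=
  pullbackBilin (g ((extChartAt 𝓘(ℝ, E) x).symm y))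
    (mfderiv 𝓘(ℝ, E) 𝓘(ℝ, E) (extChartAt 𝓘(ℝ, E) x).symm y)

/-- The Christoffel symbols of the first kind of (the Levi-Civita connection of) `g` in the chart
at `x`: in that chart, `Γ(u, v; w) = g(∇_u v, w)` for constant vector fields `u`, `v`, `w`. -/
def christoffel (g : Π x : M, TangentSpace 𝓘(ℝ, E) x →L[ℝ] TangentSpace 𝓘(ℝ, E) x →L[ℝ] ℝ)
    (x : M) (y u v w : E) : ℝ :=
  (fderiv ℝ (metricInChart g x) y u v w + fderiv ℝ (metricInChart g x) y v u w
    - fderiv ℝ (metricInChart g x) y w u v) / 2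

/-- The curve `c`, defined on the open interval `J`, is a geodesic of the metric tensor `g`: it is
smooth, and at each time `t` it satisfies the geodesic equation `c'' + Γ(c', c') = 0` in the chart
at `c t`. The equation is written with its index lowered by `g`. -/
def IsGeodesicOn
    (g : Π x : M, TangentSpace 𝓘(ℝ, E) x →L[ℝ] TangentSpace 𝓘(ℝ, E) x →L[ℝ] ℝ)
    (c : ℝ → M) (J : Set ℝ) : Prop :=
  ContMDiffOn 𝓘(ℝ, ℝ) 𝓘(ℝ, E) ∞ c J ∧
    ∀ t ∈ J, ∀ w : E,
      metricInChart g (c t) (extChartAt 𝓘(ℝ, E) (c t) (c t))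
          (deriv (deriv fun s ↦ extChartAt 𝓘(ℝ, E) (c t) (c s)) t) w
        + christoffel g (c t) (extChartAt 𝓘(ℝ, E) (c t) (c t))
            (deriv (fun s ↦ extChartAt 𝓘(ℝ, E) (c t) (c s)) t)
            (deriv (fun s ↦ extChartAt 𝓘(ℝ, E) (c t) (c s)) t) w = 0

/-- The pullback `ι^* g` of a metric tensor by a map `ι : N → M`. If `ι` is the inclusion of an
immersed submanifold, this is the induced metric. -/
def pullbackMetric {F : Type*} [NormedAddCommGroup F] [NormedSpace ℝ F]
    {N : Type*} [TopologicalSpace N] [ChartedSpace F N]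
    (g : Π x : M, TangentSpace 𝓘(ℝ, E) x →L[ℝ] TangentSpace 𝓘(ℝ, E) x →L[ℝ] ℝ)
    (ι : N → M) (p : N) :
    TangentSpace 𝓘(ℝ, F) p →L[ℝ] TangentSpace 𝓘(ℝ, F) p →L[ℝ] ℝ :=
  pullbackBilin (g (ι p)) (mfderiv 𝓘(ℝ, F) 𝓘(ℝ, E) ι p)

/-- An immersed submanifold `ι : N → M` is totally geodesic if the geodesics of `N`, for the
induced metric, are geodesics of `M`. -/
def IsTotallyGeodesic {F : Type*} [NormedAddCommGroup F] [NormedSpace ℝ F]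
    {N : Type*} [TopologicalSpace N] [ChartedSpace F N]
    (g : Π x : M, TangentSpace 𝓘(ℝ, E) x →L[ℝ] TangentSpace 𝓘(ℝ, E) x →L[ℝ] ℝ)
    (ι : N → M) : Prop :=
  ∀ (J : Set ℝ) (c : ℝ → N), IsOpen J → J.OrdConnected →
    IsGeodesicOn (E := F) (pullbackMetric (F := F) g ι) c J → IsGeodesicOn g (fun t ↦ ι (c t)) J

/-- An integral manifold of the line field spanned by `Z` (a nowhere vanishing vector field): a
smooth map `ι` from a one-dimensional manifold `N` whose differential at each point maps the
tangent space of `N` onto the line spanned by `Z`. As that line is one-dimensional, `ι` is an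
immersion. -/
def IsIntegralManifold {N : Type*} [TopologicalSpace N] [ChartedSpace ℝ N]
    (Z : Π x : M, TangentSpace 𝓘(ℝ, E) x) (ι : N → M) : Prop :=
  ContMDiff 𝓘(ℝ, ℝ) 𝓘(ℝ, E) ∞ ι ∧
    ∀ p : N, LinearMap.range (mfderiv 𝓘(ℝ, ℝ) 𝓘(ℝ, E) ι p).toLinearMap
      = Submodule.span ℝ {Z (ι p)}

/-- The foliation tangent to the nowhere vanishing vector field `Z` is totally geodesic: its
connected integral manifolds are totally geodesic. The leaves are the maximal ones among these;
each connected integral manifold lies in a leaf as an open piece or covers such a piece, and being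
a geodesic is a local property, so that it is the same to ask this of the leaves only. -/
def FoliationIsTotallyGeodesic
    (g : Π x : M, TangentSpace 𝓘(ℝ, E) x →L[ℝ] TangentSpace 𝓘(ℝ, E) x →L[ℝ] ℝ)
    (Z : Π x : M, TangentSpace 𝓘(ℝ, E) x) : Prop :=
  ∀ (N : Type) [TopologicalSpace N] [ChartedSpace ℝ N] [IsManifold 𝓘(ℝ, ℝ) ∞ N]
    [T2Space N] [SecondCountableTopology N] [ConnectedSpace N] (ι : N → M),
    IsIntegralManifold Z ι → IsTotallyGeodesic (F := ℝ) g ι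

end ZFoliation

end

noncomputable section

namespace ZFoliation

section

variable {E : Type*} [NormedAddCommGroup E] [NormedSpace ℝ E]
  {M : Type*} [TopologicalSpace M] [ChartedSpace E M]
  {F : Type*} [NormedAddCommGroup F] [NormedSpace ℝ F]

@[simp]
lemma pullbackBilin_apply {F G : Type*} [AddCommGroup F] [Module ℝ F] [TopologicalSpace F]
    [AddCommGroup G] [Module ℝ G] [TopologicalSpace G] (b : G →L[ℝ] G →L[ℝ] ℝ) (A : F →L[ℝ] G)
    (u v : F) : pullbackBilin b A u v = b (A u) (A v) :=
  rfl

section Charts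

variable [IsManifold 𝓘(ℝ, E) ∞ M]

lemma contMDiffAt_extChartAt_symm {x₀ : M} {y : E} (hy : y ∈ (extChartAt 𝓘(ℝ, E) x₀).target) :
    ContMDiffAt 𝓘(ℝ, E) 𝓘(ℝ, E) ∞ (extChartAt 𝓘(ℝ, E) x₀).symm y :=
  (contMDiffOn_extChartAt_symm x₀).contMDiffAt ((isOpen_extChartAt_target x₀).mem_nhds hy)

lemma contMDiffAt_extChartAt_of_mem {x₀ x : M} (hx : x ∈ (extChartAt 𝓘(ℝ, E) x₀).source) :
    ContMDiffAt 𝓘(ℝ, E) 𝓘(ℝ, E) ∞ (extChartAt 𝓘(ℝ, E) x₀) x := by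
  rw [extChartAt_source] at hx
  exact contMDiffAt_extChartAt' hx

/-- A map to a normed space is smooth at a point of a chart if its expression in the chart is. -/
lemma contMDiffAt_iff_comp_symm {x₀ x : M} (hx : x ∈ (extChartAt 𝓘(ℝ, E) x₀).source) {f : M → F} :
    ContMDiffAt 𝓘(ℝ, E) 𝓘(ℝ, F) ∞ f x ↔
      ContDiffAt ℝ ∞ (fun y ↦ f ((extChartAt 𝓘(ℝ, E) x₀).symm y)) (extChartAt 𝓘(ℝ, E) x₀ x) := by
  have hy := (extChartAt 𝓘(ℝ, E) x₀).map_source hx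
  have hxy := (extChartAt 𝓘(ℝ, E) x₀).left_inv hx
  constructor
  · intro h
    rw [← hxy] at h
    exact (ContMDiffAt.comp _ h (contMDiffAt_extChartAt_symm hy)).contDiffAt
  · intro h
    have h2 := ContMDiffAt.comp x h.contMDiffAt (contMDiffAt_extChartAt_of_mem hx)
    refine h2.congr_of_eventuallyEq ?_
    filter_upwards [(isOpen_extChartAt_source (I := 𝓘(ℝ, E)) x₀).mem_nhds hx] with z hz
    rw [Function.comp_apply, (extChartAt 𝓘(ℝ, E) x₀).left_inv hz]

/-- A map defined through a chart is smooth if its expression in the chart is. -/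
lemma contMDiffAt_iff_of_comp_symm_eq {x₀ x : M} (hx : x ∈ (extChartAt 𝓘(ℝ, E) x₀).source)
    {f : M → F} {k : E → F}
    (hk : ∀ z ∈ (extChartAt 𝓘(ℝ, E) x₀).source, f z = k (extChartAt 𝓘(ℝ, E) x₀ z)) :
    ContMDiffAt 𝓘(ℝ, E) 𝓘(ℝ, F) ∞ f x ↔ ContDiffAt ℝ ∞ k (extChartAt 𝓘(ℝ, E) x₀ x) := by
  rw [contMDiffAt_iff_comp_symm hx]
  suffices h : (fun y ↦ f ((extChartAt 𝓘(ℝ, E) x₀).symm y)) =ᶠ[𝓝 (extChartAt 𝓘(ℝ, E) x₀ x)] k from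
    ⟨fun h' ↦ h'.congr_of_eventuallyEq h.symm, fun h' ↦ h'.congr_of_eventuallyEq h⟩
  filter_upwards [(isOpen_extChartAt_target (I := 𝓘(ℝ, E)) x₀).mem_nhds
    ((extChartAt 𝓘(ℝ, E) x₀).map_source hx)] with y hy
  rw [hk _ ((extChartAt 𝓘(ℝ, E) x₀).map_target hy), (extChartAt 𝓘(ℝ, E) x₀).right_inv hy]

lemma mfderiv_extChartAt_symm_self (x : M) :
    mfderiv 𝓘(ℝ, E) 𝓘(ℝ, E) (extChartAt 𝓘(ℝ, E) x).symm (extChartAt 𝓘(ℝ, E) x x)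
      = ContinuousLinearMap.id ℝ E := by
  have : IsManifold 𝓘(ℝ, E) 1 M := IsManifold.of_le (n := ∞) (by norm_cast)
  have h := mfderivWithin_range_extChartAt_symm (I := 𝓘(ℝ, E)) (x := x)
  rw [ModelWithCorners.range_eq_univ, mfderivWithin_univ] at h
  exact h

lemma mfderiv_extChartAt_self' (x : M) :
    mfderiv 𝓘(ℝ, E) 𝓘(ℝ, E) (extChartAt 𝓘(ℝ, E) x) x = ContinuousLinearMap.id ℝ E := by
  have : IsManifold 𝓘(ℝ, E) 1 M := IsManifold.of_le (n := ∞) (by norm_cast)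
  exact mfderiv_extChartAt_self (I := 𝓘(ℝ, E)) (x := x)

lemma mfderiv_extChartAt_mfderiv_symm {x₀ : M} {y : E}
    (hy : y ∈ (extChartAt 𝓘(ℝ, E) x₀).target) (w : E) :
    mfderiv 𝓘(ℝ, E) 𝓘(ℝ, E) (extChartAt 𝓘(ℝ, E) x₀) ((extChartAt 𝓘(ℝ, E) x₀).symm y)
      (mfderiv 𝓘(ℝ, E) 𝓘(ℝ, E) (extChartAt 𝓘(ℝ, E) x₀).symm y w) = w := by
  have : IsManifold 𝓘(ℝ, E) 1 M := IsManifold.of_le (n := ∞) (by norm_cast)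
  have h := mfderiv_extChartAt_comp_mfderivWithin_extChartAt_symm (I := 𝓘(ℝ, E)) hy
  rw [ModelWithCorners.range_eq_univ, mfderivWithin_univ] at h
  exact DFunLike.congr_fun h w

lemma mfderiv_extChartAt_symm_mfderiv {x₀ x : M}
    (hx : x ∈ (extChartAt 𝓘(ℝ, E) x₀).source) (v : TangentSpace 𝓘(ℝ, E) x) :
    mfderiv 𝓘(ℝ, E) 𝓘(ℝ, E) (extChartAt 𝓘(ℝ, E) x₀).symm (extChartAt 𝓘(ℝ, E) x₀ x)
      (mfderiv 𝓘(ℝ, E) 𝓘(ℝ, E) (extChartAt 𝓘(ℝ, E) x₀) x v) = v := by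
  have : IsManifold 𝓘(ℝ, E) 1 M := IsManifold.of_le (n := ∞) (by norm_cast)
  have h := mfderivWithin_extChartAt_symm_comp_mfderiv_extChartAt' (I := 𝓘(ℝ, E)) hx
  rw [ModelWithCorners.range_eq_univ, mfderivWithin_univ] at h
  exact DFunLike.congr_fun h v

lemma oneFormInChart_self (α : Π x : M, TangentSpace 𝓘(ℝ, E) x →L[ℝ] ℝ) (x : M) (v : E) :
    oneFormInChart α x (extChartAt 𝓘(ℝ, E) x x) v = α x v := by
  unfold oneFormInChart
  rw [mfderiv_extChartAt_symm_self, extChartAt_to_inv]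
  rfl

lemma metricInChart_self
    (g : Π x : M, TangentSpace 𝓘(ℝ, E) x →L[ℝ] TangentSpace 𝓘(ℝ, E) x →L[ℝ] ℝ) (x : M) (v w : E) :
    metricInChart g x (extChartAt 𝓘(ℝ, E) x x) v w = g x v w := by
  unfold metricInChart
  rw [mfderiv_extChartAt_symm_self, extChartAt_to_inv]
  rfl

lemma vectorFieldInChart_eq (X : Π x : M, TangentSpace 𝓘(ℝ, E) x) {x₀ : M} {y : E}
    (hy : y ∈ (extChartAt 𝓘(ℝ, E) x₀).target) :
    vectorFieldInChart X x₀ y = mfderiv 𝓘(ℝ, E) 𝓘(ℝ, E) (extChartAt 𝓘(ℝ, E) x₀)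
      ((extChartAt 𝓘(ℝ, E) x₀).symm y) (X ((extChartAt 𝓘(ℝ, E) x₀).symm y)) := by
  have : IsManifold 𝓘(ℝ, E) 1 M := IsManifold.of_le (n := ∞) (by norm_cast)
  unfold vectorFieldInChart
  rw [VectorField.mpullback_apply]
  have h := ContinuousLinearMap.inverse_eq
    (f := mfderiv 𝓘(ℝ, E) 𝓘(ℝ, E) (extChartAt 𝓘(ℝ, E) x₀).symm y)
    (g := mfderiv 𝓘(ℝ, E) 𝓘(ℝ, E) (extChartAt 𝓘(ℝ, E) x₀) ((extChartAt 𝓘(ℝ, E) x₀).symm y)) ?_ ?_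
  · exact DFunLike.congr_fun h _
  · have h := mfderivWithin_extChartAt_symm_comp_mfderiv_extChartAt (I := 𝓘(ℝ, E)) hy
    rwa [ModelWithCorners.range_eq_univ, mfderivWithin_univ] at h
  · have h := mfderiv_extChartAt_comp_mfderivWithin_extChartAt_symm (I := 𝓘(ℝ, E)) hy
    rwa [ModelWithCorners.range_eq_univ, mfderivWithin_univ] at h

lemma vectorFieldInChart_extChartAt (X : Π x : M, TangentSpace 𝓘(ℝ, E) x) {x₀ x : M}
    (hx : x ∈ (extChartAt 𝓘(ℝ, E) x₀).source) :
    vectorFieldInChart X x₀ (extChartAt 𝓘(ℝ, E) x₀ x)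
      = mfderiv 𝓘(ℝ, E) 𝓘(ℝ, E) (extChartAt 𝓘(ℝ, E) x₀) x (X x) := by
  rw [vectorFieldInChart_eq X ((extChartAt 𝓘(ℝ, E) x₀).map_source hx),
    (extChartAt 𝓘(ℝ, E) x₀).left_inv hx]

lemma vectorFieldInChart_self (X : Π x : M, TangentSpace 𝓘(ℝ, E) x) (x : M) :
    vectorFieldInChart X x (extChartAt 𝓘(ℝ, E) x x) = X x := by
  rw [vectorFieldInChart_extChartAt X (mem_extChartAt_source x), mfderiv_extChartAt_self']
  rfl

lemma mfderiv_symm_vectorFieldInChart (X : Π x : M, TangentSpace 𝓘(ℝ, E) x) {x₀ : M} {y : E}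
    (hy : y ∈ (extChartAt 𝓘(ℝ, E) x₀).target) :
    mfderiv 𝓘(ℝ, E) 𝓘(ℝ, E) (extChartAt 𝓘(ℝ, E) x₀).symm y
      (vectorFieldInChart (E := E) X x₀ y) = X ((extChartAt 𝓘(ℝ, E) x₀).symm y) := by
  rw [vectorFieldInChart_eq X hy]
  have h := mfderiv_extChartAt_symm_mfderiv ((extChartAt 𝓘(ℝ, E) x₀).map_target hy)
    (X ((extChartAt 𝓘(ℝ, E) x₀).symm y))
  rwa [(extChartAt 𝓘(ℝ, E) x₀).right_inv hy] at h

/-- Smoothness of a vector field in terms of its expression in a chart. -/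
lemma contMDiffAt_vectorField_iff (X : Π x : M, TangentSpace 𝓘(ℝ, E) x) {x₀ x : M}
    (hx : x ∈ (extChartAt 𝓘(ℝ, E) x₀).source) :
    ContMDiffAt 𝓘(ℝ, E) 𝓘(ℝ, E).tangent ∞
      (fun x ↦ (Bundle.TotalSpace.mk' E x (X x) : TangentBundle 𝓘(ℝ, E) M)) x ↔
    ContDiffAt ℝ ∞ (vectorFieldInChart X x₀) (extChartAt 𝓘(ℝ, E) x₀ x) := by
  have : IsManifold 𝓘(ℝ, E) 1 M := IsManifold.of_le (n := ∞) (by norm_cast)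
  have hx' : x ∈ (trivializationAt E (TangentSpace 𝓘(ℝ, E) : M → Type _) x₀).baseSet := by
    simpa using hx
  refine (Bundle.Trivialization.contMDiffAt_section_iff _ hx').trans ?_
  refine contMDiffAt_iff_of_comp_symm_eq hx fun z hz ↦ ?_
  rw [vectorFieldInChart_extChartAt X hz]
  have hz' : z ∈ (chartAt E x₀).source := by simpa using hz
  refine Eq.trans ?_ (DFunLike.congr_fun
    (TangentBundle.continuousLinearMapAt_trivializationAt (I := 𝓘(ℝ, E)) hz') (X z))
  rw [Bundle.Trivialization.continuousLinearMapAt_apply,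
    Bundle.Trivialization.coe_linearMapAt_of_mem _ (by simpa using hz)]

/-- Smoothness of a one-form in terms of its expression in a chart. -/
lemma contMDiffAt_oneForm_iff (α : Π x : M, TangentSpace 𝓘(ℝ, E) x →L[ℝ] ℝ) {x₀ x : M}
    (hx : x ∈ (extChartAt 𝓘(ℝ, E) x₀).source) :
    ContMDiffAt 𝓘(ℝ, E) (𝓘(ℝ, E).prod 𝓘(ℝ, E →L[ℝ] ℝ)) ∞
      (fun x ↦ Bundle.TotalSpace.mk' (E →L[ℝ] ℝ)
        (E := fun x : M ↦ TangentSpace 𝓘(ℝ, E) x →L[ℝ] ℝ) x (α x)) x ↔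
    ContDiffAt ℝ ∞ (oneFormInChart α x₀) (extChartAt 𝓘(ℝ, E) x₀ x) := by
  have : IsManifold 𝓘(ℝ, E) 1 M := IsManifold.of_le (n := ∞) (by norm_cast)
  have hx' : x ∈ (trivializationAt (E →L[ℝ] ℝ)
      (fun x : M ↦ TangentSpace 𝓘(ℝ, E) x →L[ℝ] ℝ) x₀).baseSet := by
    rw [hom_trivializationAt_baseSet]
    simpa using hx
  refine (Bundle.Trivialization.contMDiffAt_section_iff _ hx').trans ?_
  refine contMDiffAt_iff_of_comp_symm_eq hx fun z hz ↦ ?_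
  rw [hom_trivializationAt_apply]
  ext w
  unfold oneFormInChart ContinuousLinearMap.inCoordinates
  rw [TangentBundle.symmL_trivializationAt (by simpa using hz), ModelWithCorners.range_eq_univ,
    mfderivWithin_univ, (extChartAt 𝓘(ℝ, E) x₀).left_inv hz]
  simp

set_option synthInstance.maxHeartbeats 400000 in
set_option maxHeartbeats 1000000 in
/-- Smoothness of a field of bilinear forms in terms of its expression in a chart. -/
lemma contMDiffAt_metric_iff
    (g : Π x : M, TangentSpace 𝓘(ℝ, E) x →L[ℝ] TangentSpace 𝓘(ℝ, E) x →L[ℝ] ℝ) {x₀ x : M}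
    (hx : x ∈ (extChartAt 𝓘(ℝ, E) x₀).source) :
    ContMDiffAt 𝓘(ℝ, E) (𝓘(ℝ, E).prod 𝓘(ℝ, E →L[ℝ] E →L[ℝ] ℝ)) ∞
      (fun x ↦ Bundle.TotalSpace.mk' (E →L[ℝ] E →L[ℝ] ℝ)
        (E := fun x : M ↦ TangentSpace 𝓘(ℝ, E) x →L[ℝ] TangentSpace 𝓘(ℝ, E) x →L[ℝ] ℝ) x (g x)) x ↔
    ContDiffAt ℝ ∞ (metricInChart g x₀) (extChartAt 𝓘(ℝ, E) x₀ x) := by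
  have : IsManifold 𝓘(ℝ, E) 1 M := IsManifold.of_le (n := ∞) (by norm_cast)
  have hx' : x ∈ (trivializationAt (E →L[ℝ] E →L[ℝ] ℝ)
      (fun x : M ↦ TangentSpace 𝓘(ℝ, E) x →L[ℝ] TangentSpace 𝓘(ℝ, E) x →L[ℝ] ℝ) x₀).baseSet := by
    rw [hom_trivializationAt_baseSet, hom_trivializationAt_baseSet]
    simpa using hx
  refine (Bundle.Trivialization.contMDiffAt_section_iff (trivializationAt (E →L[ℝ] E →L[ℝ] ℝ)
      (fun x : M ↦ TangentSpace 𝓘(ℝ, E) x →L[ℝ] TangentSpace 𝓘(ℝ, E) x →L[ℝ] ℝ) x₀) hx').trans ?_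
  refine contMDiffAt_iff_of_comp_symm_eq hx fun z hz ↦ ?_
  rw [hom_trivializationAt_apply]
  ext v w
  rw [inCoordinates_apply_eq₂ (by simpa using hz) (by simpa using hz) (by simp)]
  unfold metricInChart
  rw [(extChartAt 𝓘(ℝ, E) x₀).left_inv hz]
  rw [← mfderivWithin_univ, ← ModelWithCorners.range_eq_univ 𝓘(ℝ, E),
    ← TangentBundle.symmL_trivializationAt (by simpa using hz)]
  rw [pullbackBilin_apply, Bundle.Trivialization.symmL_apply _ (by simpa using hz),
    Bundle.Trivialization.symmL_apply _ (by simpa using hz)]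
  simp

end Charts

end

section

variable {E : Type*} [NormedAddCommGroup E] [NormedSpace ℝ E]
  {M : Type*} [TopologicalSpace M] [ChartedSpace E M]

lemma differentiableAt_ofSubsingleton {a : E → E →L[ℝ] ℝ} {y : E} (ha : DifferentiableAt ℝ a y) :
    DifferentiableAt ℝ
      (fun y : E ↦ ContinuousAlternatingMap.ofSubsingleton ℝ E ℝ (0 : Fin 1) (a y)) y :=
  (ContinuousAlternatingMap.ofSubsingletonLIE (𝕜 := ℝ) (E := E) (F := ℝ)
    (0 : Fin 1)).differentiable.differentiableAt.comp y ha

lemma extDeriv_ofSubsingleton_apply {a : E → E →L[ℝ] ℝ} {y : E} (ha : DifferentiableAt ℝ a y)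
    (v w : E) :
    extDeriv (fun y : E ↦ ContinuousAlternatingMap.ofSubsingleton ℝ E ℝ (0 : Fin 1) (a y)) y ![v, w]
      = fderiv ℝ a y v w - fderiv ℝ a y w v := by
  have h := differentiableAt_ofSubsingleton ha
  have h1 (v w : E) : fderiv ℝ (fun y ↦ a y w) y v = fderiv ℝ a y v w := by
    rw [fderiv_clm_apply ha (differentiableAt_const w)]
    simp
  rw [extDeriv_apply h]
  simp [Fin.sum_univ_two, Fin.removeNth, h1, ← sub_eq_add_neg]

lemma eventually_mem_target (x : M) :
    ∀ᶠ y in 𝓝 (extChartAt 𝓘(ℝ, E) x x), y ∈ (extChartAt 𝓘(ℝ, E) x).target :=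
  (isOpen_extChartAt_target x).mem_nhds (mem_extChartAt_target x)

lemma oneFormInChart_smul (u : M → ℝ) (α : Π x : M, TangentSpace 𝓘(ℝ, E) x →L[ℝ] ℝ) (x₀ : M) :
    oneFormInChart (fun p ↦ u p • α p) x₀ =
      fun y ↦ u ((extChartAt 𝓘(ℝ, E) x₀).symm y) • oneFormInChart α x₀ y :=
  rfl

lemma oneFormInChart_add (α β : Π x : M, TangentSpace 𝓘(ℝ, E) x →L[ℝ] ℝ) (x₀ : M) :
    oneFormInChart (fun p ↦ α p + β p) x₀ =
      fun y ↦ oneFormInChart α x₀ y + oneFormInChart β x₀ y :=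
  rfl

section Charts

variable [IsManifold 𝓘(ℝ, E) ∞ M]

/-- The exterior derivative of a one-form at `x`, in the chart at `x`. -/
lemma extD_apply {α : Π x : M, TangentSpace 𝓘(ℝ, E) x →L[ℝ] ℝ} {x : M}
    (hα : DifferentiableAt ℝ (oneFormInChart α x) (extChartAt 𝓘(ℝ, E) x x)) (v w : E) :
    extD α x ![v, w] = fderiv ℝ (oneFormInChart α x) (extChartAt 𝓘(ℝ, E) x x) v w
      - fderiv ℝ (oneFormInChart α x) (extChartAt 𝓘(ℝ, E) x x) w v := by
  rw [← extDeriv_ofSubsingleton_apply hα]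
  unfold extD
  rw [mfderiv_extChartAt_self']
  rfl

lemma contDiffAt_transition {x₀ x : M} (hx : x ∈ (extChartAt 𝓘(ℝ, E) x₀).source) :
    ContDiffAt ℝ ∞ (fun y ↦ extChartAt 𝓘(ℝ, E) x₀ ((extChartAt 𝓘(ℝ, E) x).symm y))
      (extChartAt 𝓘(ℝ, E) x x) := by
  rw [← contMDiffAt_iff_comp_symm (mem_extChartAt_source x)]
  exact contMDiffAt_extChartAt_of_mem hx

lemma fderiv_transition {x₀ x : M} {y : E} (hy : y ∈ (extChartAt 𝓘(ℝ, E) x).target)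
    (hx : (extChartAt 𝓘(ℝ, E) x).symm y ∈ (extChartAt 𝓘(ℝ, E) x₀).source) (w : E) :
    fderiv ℝ (fun y ↦ extChartAt 𝓘(ℝ, E) x₀ ((extChartAt 𝓘(ℝ, E) x).symm y)) y w =
      mfderiv 𝓘(ℝ, E) 𝓘(ℝ, E) (extChartAt 𝓘(ℝ, E) x₀) ((extChartAt 𝓘(ℝ, E) x).symm y)
        (mfderiv 𝓘(ℝ, E) 𝓘(ℝ, E) (extChartAt 𝓘(ℝ, E) x).symm y w) := by
  rw [← mfderiv_eq_fderiv]
  have h := mfderiv_comp y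
    ((contMDiffAt_extChartAt_of_mem hx).mdifferentiableAt (by simp))
    ((contMDiffAt_extChartAt_symm hy).mdifferentiableAt (by simp))
  exact DFunLike.congr_fun h w

lemma oneFormInChart_change {α : Π x : M, TangentSpace 𝓘(ℝ, E) x →L[ℝ] ℝ} {x₀ x : M} {y : E}
    (hy : y ∈ (extChartAt 𝓘(ℝ, E) x).target)
    (hx : (extChartAt 𝓘(ℝ, E) x).symm y ∈ (extChartAt 𝓘(ℝ, E) x₀).source) :
    oneFormInChart α x y =
      (oneFormInChart α x₀ (extChartAt 𝓘(ℝ, E) x₀ ((extChartAt 𝓘(ℝ, E) x).symm y))).comp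
        (fderiv ℝ (fun y ↦ extChartAt 𝓘(ℝ, E) x₀ ((extChartAt 𝓘(ℝ, E) x).symm y)) y) := by
  ext w
  rw [ContinuousLinearMap.comp_apply, fderiv_transition hy hx]
  unfold oneFormInChart
  have h := mfderiv_extChartAt_symm_mfderiv hx
    (mfderiv 𝓘(ℝ, E) 𝓘(ℝ, E) (extChartAt 𝓘(ℝ, E) x).symm y w)
  refine Eq.trans ?_ (congrArg (α ((extChartAt 𝓘(ℝ, E) x₀).symm (extChartAt 𝓘(ℝ, E) x₀
    ((extChartAt 𝓘(ℝ, E) x).symm y)))) h.symm)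
  rw [(extChartAt 𝓘(ℝ, E) x₀).left_inv hx]
  rfl

/-- The exterior derivative of a one-form at `x`, computed in the chart at another point. -/
lemma extD_apply_of_mem {α : Π x : M, TangentSpace 𝓘(ℝ, E) x →L[ℝ] ℝ} {x₀ x : M}
    (hx : x ∈ (extChartAt 𝓘(ℝ, E) x₀).source)
    (hα : DifferentiableAt ℝ (oneFormInChart α x₀) (extChartAt 𝓘(ℝ, E) x₀ x))
    (v w : TangentSpace 𝓘(ℝ, E) x) :
    extD α x ![v, w] =
      fderiv ℝ (oneFormInChart α x₀) (extChartAt 𝓘(ℝ, E) x₀ x)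
          (mfderiv 𝓘(ℝ, E) 𝓘(ℝ, E) (extChartAt 𝓘(ℝ, E) x₀) x v)
          (mfderiv 𝓘(ℝ, E) 𝓘(ℝ, E) (extChartAt 𝓘(ℝ, E) x₀) x w)
        - fderiv ℝ (oneFormInChart α x₀) (extChartAt 𝓘(ℝ, E) x₀ x)
          (mfderiv 𝓘(ℝ, E) 𝓘(ℝ, E) (extChartAt 𝓘(ℝ, E) x₀) x w)
          (mfderiv 𝓘(ℝ, E) 𝓘(ℝ, E) (extChartAt 𝓘(ℝ, E) x₀) x v) := by
  set y := extChartAt 𝓘(ℝ, E) x x with hy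
  set T : E → E := fun y ↦ extChartAt 𝓘(ℝ, E) x₀ ((extChartAt 𝓘(ℝ, E) x).symm y) with hT
  have hTy : T y = extChartAt 𝓘(ℝ, E) x₀ x := by rw [hT, hy]; simp
  have hyt : y ∈ (extChartAt 𝓘(ℝ, E) x).target := mem_extChartAt_target x
  have hev : ∀ᶠ z in 𝓝 y, z ∈ (extChartAt 𝓘(ℝ, E) x).target ∧
      (extChartAt 𝓘(ℝ, E) x).symm z ∈ (extChartAt 𝓘(ℝ, E) x₀).source := by
    refine Filter.Eventually.and ((isOpen_extChartAt_target x).mem_nhds hyt) ?_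
    refine (contMDiffAt_extChartAt_symm hyt).continuousAt.eventually_mem ?_
    rw [hy, extChartAt_to_inv]
    exact (isOpen_extChartAt_source x₀).mem_nhds hx
  have hω : DifferentiableAt ℝ (fun y : E ↦
      ContinuousAlternatingMap.ofSubsingleton ℝ E ℝ (0 : Fin 1) (oneFormInChart α x₀ y)) (T y) := by
    rw [hTy]
    exact differentiableAt_ofSubsingleton hα
  have h1 := extDeriv_pullback (r := ∞) hω (contDiffAt_transition hx)
    (by rw [minSmoothness_of_isRCLikeNormedField]; norm_cast)
  have h2 : (fun z : E ↦ ContinuousAlternatingMap.ofSubsingleton ℝ E ℝ (0 : Fin 1)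
      (oneFormInChart α x z)) =ᶠ[𝓝 y] fun z ↦ (ContinuousAlternatingMap.ofSubsingleton ℝ E ℝ
        (0 : Fin 1) (oneFormInChart α x₀ (T z))).compContinuousLinearMap (fderiv ℝ T z) := by
    filter_upwards [hev] with z hz
    rw [oneFormInChart_change hz.1 hz.2]
    rfl
  refine Eq.trans ?_ (extDeriv_ofSubsingleton_apply hα _ _)
  unfold extD
  rw [h2.extDeriv_eq, mfderiv_extChartAt_self', h1, hTy]
  have h3 (u : E) : fderiv ℝ T y u =
      mfderiv 𝓘(ℝ, E) 𝓘(ℝ, E) (extChartAt 𝓘(ℝ, E) x₀) x u := by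
    rw [hT, fderiv_transition hyt hev.self_of_nhds.2, hy, mfderiv_extChartAt_symm_self,
      extChartAt_to_inv]
    rfl
  refine congrArg (extDeriv _ _) ?_
  ext i
  fin_cases i
  · exact h3 v
  · exact h3 w

lemma IsSmoothOneForm.contDiffAt {α : Π x : M, TangentSpace 𝓘(ℝ, E) x →L[ℝ] ℝ}
    (hα : IsSmoothOneForm α) {x₀ x : M} (hx : x ∈ (extChartAt 𝓘(ℝ, E) x₀).source) :
    ContDiffAt ℝ ∞ (oneFormInChart α x₀) (extChartAt 𝓘(ℝ, E) x₀ x) :=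
  (contMDiffAt_oneForm_iff α hx).1 hα.contMDiffAt

lemma IsSmoothVectorFieldOn.contDiffAt {X : Π x : M, TangentSpace 𝓘(ℝ, E) x} {U : Set M}
    (hX : IsSmoothVectorFieldOn X U) {x₀ x : M} (hU : U ∈ 𝓝 x)
    (hx : x ∈ (extChartAt 𝓘(ℝ, E) x₀).source) :
    ContDiffAt ℝ ∞ (vectorFieldInChart X x₀) (extChartAt 𝓘(ℝ, E) x₀ x) :=
  (contMDiffAt_vectorField_iff X hx).1 (hX.contMDiffAt hU)

lemma IsSmoothVectorField.contDiffAt {X : Π x : M, TangentSpace 𝓘(ℝ, E) x}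
    (hX : IsSmoothVectorField X) {x₀ x : M} (hx : x ∈ (extChartAt 𝓘(ℝ, E) x₀).source) :
    ContDiffAt ℝ ∞ (vectorFieldInChart X x₀) (extChartAt 𝓘(ℝ, E) x₀ x) :=
  IsSmoothVectorFieldOn.contDiffAt hX Filter.univ_mem hx

lemma oneFormInChart_vectorFieldInChart (α : Π x : M, TangentSpace 𝓘(ℝ, E) x →L[ℝ] ℝ)
    (X : Π x : M, TangentSpace 𝓘(ℝ, E) x) {x₀ : M} {y : E}
    (hy : y ∈ (extChartAt 𝓘(ℝ, E) x₀).target) :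
    oneFormInChart α x₀ y (vectorFieldInChart X x₀ y) =
      α ((extChartAt 𝓘(ℝ, E) x₀).symm y) (X ((extChartAt 𝓘(ℝ, E) x₀).symm y)) := by
  rw [← mfderiv_symm_vectorFieldInChart X hy]
  rfl

/-- Cartan's formula for a one-form which is constant on the vector field. -/
lemma lieDerivOneForm_apply {Z : Π x : M, TangentSpace 𝓘(ℝ, E) x}
    {τ : Π x : M, TangentSpace 𝓘(ℝ, E) x →L[ℝ] ℝ} (hτ : IsSmoothOneForm τ)
    (hZ : IsSmoothVectorField Z) {c : ℝ} (hτZ : ∀ x, τ x (Z x) = c) (x : M)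
    (w : TangentSpace 𝓘(ℝ, E) x) :
    lieDerivOneForm Z τ x w = extD τ x ![Z x, w] := by
  have h1 := (hτ.contDiffAt (mem_extChartAt_source x)).differentiableAt (by simp)
  have h2 := (hZ.contDiffAt (mem_extChartAt_source x)).differentiableAt (by simp)
  have h3 : (fun y ↦ oneFormInChart τ x y (vectorFieldInChart Z x y))
      =ᶠ[𝓝 (extChartAt 𝓘(ℝ, E) x x)] fun _ ↦ c := by
    filter_upwards [eventually_mem_target x] with y hy
    rw [oneFormInChart_vectorFieldInChart τ Z hy, hτZ]
  have h4 := DFunLike.congr_fun (h3.fderiv_eq (𝕜 := ℝ)) (w : E)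
  rw [fderiv_clm_apply h1 h2, fderiv_fun_const] at h4
  refine Eq.trans ?_ (extD_apply h1 (Z x) w).symm
  unfold lieDerivOneForm
  rw [mfderiv_extChartAt_self', vectorFieldInChart_self]
  rw [vectorFieldInChart_self] at h4
  change oneFormInChart τ x (extChartAt 𝓘(ℝ, E) x x)
      (fderiv ℝ (vectorFieldInChart Z x) (extChartAt 𝓘(ℝ, E) x x) w) +
    (fderiv ℝ (oneFormInChart τ x) (extChartAt 𝓘(ℝ, E) x x) w) (Z x) = 0 at h4
  change (fderiv ℝ (oneFormInChart τ x) (extChartAt 𝓘(ℝ, E) x x) (Z x)) w +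
    oneFormInChart τ x (extChartAt 𝓘(ℝ, E) x x)
      (fderiv ℝ (vectorFieldInChart Z x) (extChartAt 𝓘(ℝ, E) x x) w) = _
  linarith

/-- The differential of a function, as a one-form. -/
def diffForm (h : M → ℝ) (x : M) : TangentSpace 𝓘(ℝ, E) x →L[ℝ] ℝ :=
  mfderiv 𝓘(ℝ, E) 𝓘(ℝ, ℝ) h x

lemma oneFormInChart_diffForm {h : M → ℝ} {x₀ : M} {y : E}
    (hy : y ∈ (extChartAt 𝓘(ℝ, E) x₀).target)
    (hh : MDifferentiableAt 𝓘(ℝ, E) 𝓘(ℝ, ℝ) h ((extChartAt 𝓘(ℝ, E) x₀).symm y)) :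
    oneFormInChart (diffForm h) x₀ y =
      fderiv ℝ (fun y ↦ h ((extChartAt 𝓘(ℝ, E) x₀).symm y)) y := by
  rw [← mfderiv_eq_fderiv]
  exact (mfderiv_comp y hh ((contMDiffAt_extChartAt_symm hy).mdifferentiableAt (by simp))).symm

lemma diffForm_apply {h : M → ℝ} {x : M} (hh : MDifferentiableAt 𝓘(ℝ, E) 𝓘(ℝ, ℝ) h x) (v : E) :
    diffForm h x v =
      fderiv ℝ (fun y ↦ h ((extChartAt 𝓘(ℝ, E) x).symm y)) (extChartAt 𝓘(ℝ, E) x x) v := by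
  rw [← oneFormInChart_diffForm (mem_extChartAt_target x) (by rwa [extChartAt_to_inv]),
    oneFormInChart_self]

lemma contDiffAt_oneFormInChart_diffForm {h : M → ℝ} (hh : ContMDiff 𝓘(ℝ, E) 𝓘(ℝ, ℝ) ∞ h) {x₀ x : M}
    (hx : x ∈ (extChartAt 𝓘(ℝ, E) x₀).source) :
    ContDiffAt ℝ ∞ (oneFormInChart (diffForm h) x₀) (extChartAt 𝓘(ℝ, E) x₀ x) := by
  have h1 := ((contMDiffAt_iff_comp_symm hx).1 hh.contMDiffAt).fderiv_right (m := ∞) (by simp)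
  refine h1.congr_of_eventuallyEq ?_
  filter_upwards [(isOpen_extChartAt_target x₀).mem_nhds
    ((extChartAt 𝓘(ℝ, E) x₀).map_source hx)] with y hy
  exact oneFormInChart_diffForm hy (hh.mdifferentiableAt (by simp))

lemma extD_diffForm {h : M → ℝ} (hh : ContMDiff 𝓘(ℝ, E) 𝓘(ℝ, ℝ) ∞ h) (x : M) (v w : E) :
    extD (diffForm h) x ![v, w] = 0 := by
  rw [extD_apply ((contDiffAt_oneFormInChart_diffForm hh
    (mem_extChartAt_source x)).differentiableAt (by simp))]
  have h0 : oneFormInChart (diffForm h) x =ᶠ[𝓝 (extChartAt 𝓘(ℝ, E) x x)]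
      fderiv ℝ (fun y ↦ h ((extChartAt 𝓘(ℝ, E) x).symm y)) := by
    filter_upwards [eventually_mem_target x] with y hy
    exact oneFormInChart_diffForm hy (hh.mdifferentiableAt (by simp))
  have h1 := (contMDiffAt_iff_comp_symm (mem_extChartAt_source x)).1 (hh.contMDiffAt (x := x))
  rw [h0.fderiv_eq, sub_eq_zero]
  exact (h1.isSymmSndFDerivAt
    (by rw [minSmoothness_of_isRCLikeNormedField]; norm_cast)).eq v w

lemma extD_smul_apply {u : M → ℝ} {α : Π x : M, TangentSpace 𝓘(ℝ, E) x →L[ℝ] ℝ} {x : M}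
    (hu : ContMDiffAt 𝓘(ℝ, E) 𝓘(ℝ, ℝ) ∞ u x)
    (hα : DifferentiableAt ℝ (oneFormInChart α x) (extChartAt 𝓘(ℝ, E) x x)) (v w : E) :
    extD (fun p ↦ u p • α p) x ![v, w] =
      diffForm u x v * α x w - diffForm u x w * α x v + u x * extD α x ![v, w] := by
  have hu1 := ((contMDiffAt_iff_comp_symm (mem_extChartAt_source x)).1 hu).differentiableAt
    (by simp)
  have h1 : DifferentiableAt ℝ (oneFormInChart (fun p ↦ u p • α p) x)
      (extChartAt 𝓘(ℝ, E) x x) := by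
    rw [oneFormInChart_smul]; exact hu1.smul hα
  rw [extD_apply h1, extD_apply hα, diffForm_apply (hu.mdifferentiableAt (by simp)),
    diffForm_apply (hu.mdifferentiableAt (by simp)), oneFormInChart_smul, fderiv_fun_smul hu1 hα,
    ← oneFormInChart_self α, ← oneFormInChart_self α, extChartAt_to_inv]
  simp only [add_apply, smul_apply,
    ContinuousLinearMap.smulRight_apply, smul_eq_mul]
  ring

lemma extD_add_apply {α β : Π x : M, TangentSpace 𝓘(ℝ, E) x →L[ℝ] ℝ} {x : M}
    (hα : DifferentiableAt ℝ (oneFormInChart α x) (extChartAt 𝓘(ℝ, E) x x))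
    (hβ : DifferentiableAt ℝ (oneFormInChart β x) (extChartAt 𝓘(ℝ, E) x x)) (v w : E) :
    extD (fun p ↦ α p + β p) x ![v, w] = extD α x ![v, w] + extD β x ![v, w] := by
  have h1 : DifferentiableAt ℝ (oneFormInChart (fun p ↦ α p + β p) x)
      (extChartAt 𝓘(ℝ, E) x x) := by
    rw [oneFormInChart_add]; exact hα.add hβ
  rw [extD_apply h1, extD_apply hα, extD_apply hβ, oneFormInChart_add, fderiv_fun_add hα hβ]
  simp only [add_apply]
  ring

end Charts

lemma evalBivector_sum {F : Type*} [AddCommGroup F] [Module ℝ F] [TopologicalSpace F]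
    (η : F [⋀^Fin 2]→L[ℝ] ℝ) {k : ℕ} (X Y : Fin k → F) :
    evalBivector η (∑ i, exteriorPower.ιMulti ℝ 2 ![X i, Y i]) = ∑ i, η ![X i, Y i] := by
  unfold evalBivector
  rw [map_sum]
  refine Finset.sum_congr rfl fun i _ ↦ ?_
  rw [exteriorPower.alternatingMapLinearEquiv_apply_ιMulti]
  rfl

end

section

variable {E : Type*} [NormedAddCommGroup E] [NormedSpace ℝ E]
  {M : Type*} [TopologicalSpace M] [ChartedSpace E M]

/-- For a unit vector field `X`, the lowered acceleration `g(∇_X X, w)` is `dθ(X, w)`, where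
`θ = g(X, ·)`. -/
lemma acceleration_eq_of_unit {G : E → E →L[ℝ] E →L[ℝ] ℝ} {X : E → E} {y : E}
    (hG : DifferentiableAt ℝ G y) (hX : DifferentiableAt ℝ X y)
    (hsymm : ∀ v w, G y v w = G y w v) (hunit : (fun z ↦ G z (X z) (X z)) =ᶠ[𝓝 y] fun _ ↦ 1)
    (w : E) :
    G y (fderiv ℝ X y (X y)) w + (fderiv ℝ G y (X y) (X y) w + fderiv ℝ G y (X y) (X y) w
        - fderiv ℝ G y w (X y) (X y)) / 2 =
      fderiv ℝ (fun z ↦ G z (X z)) y (X y) w - fderiv ℝ (fun z ↦ G z (X z)) y w (X y) := by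
  have h1 (v w : E) : fderiv ℝ (fun z ↦ G z (X z)) y v w =
      fderiv ℝ G y v (X y) w + G y (fderiv ℝ X y v) w := by
    rw [fderiv_clm_apply hG hX]
    simp [add_comm]
  have h2 := DFunLike.congr_fun (hunit.fderiv_eq (𝕜 := ℝ)) w
  rw [fderiv_clm_apply (hG.clm_apply hX) hX] at h2
  simp only [fderiv_fun_const, Pi.zero_apply, zero_apply, add_apply,
    ContinuousLinearMap.comp_apply, ContinuousLinearMap.flip_apply, h1] at h2
  rw [h1, h1, hsymm (fderiv ℝ X y w)]
  rw [hsymm (fderiv ℝ X y w)] at h2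
  linarith

lemma diffForm_exp {h : M → ℝ} {x : M} (hh : MDifferentiableAt 𝓘(ℝ, E) 𝓘(ℝ, ℝ) h x)
    (v : TangentSpace 𝓘(ℝ, E) x) :
    diffForm (fun p ↦ Real.exp (h p)) x v = Real.exp (h x) * diffForm h x v := by
  have h1 : HasMFDerivAt 𝓘(ℝ, ℝ) 𝓘(ℝ, ℝ) Real.exp (h x)
      (ContinuousLinearMap.toSpanSingleton ℝ (Real.exp (h x))) :=
    (Real.hasDerivAt_exp (h x)).hasFDerivAt.hasMFDerivAt
  have h2 := (h1.comp x hh.hasMFDerivAt).mfderiv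
  refine (DFunLike.congr_fun h2 v).trans ?_
  exact mul_comm (diffForm h x v) (Real.exp (h x))

section Charts

variable [IsManifold 𝓘(ℝ, E) ∞ M]

/-- The acceleration `g(∇_X X, w)` of the integral curves of `X`, in the chart at `x`. -/
def loweredAcceleration
    (g : Π x : M, TangentSpace 𝓘(ℝ, E) x →L[ℝ] TangentSpace 𝓘(ℝ, E) x →L[ℝ] ℝ)
    (X : Π x : M, TangentSpace 𝓘(ℝ, E) x) (x : M) (w : TangentSpace 𝓘(ℝ, E) x) : ℝ :=
  metricInChart g x (extChartAt 𝓘(ℝ, E) x x)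
      (fderiv ℝ (vectorFieldInChart X x) (extChartAt 𝓘(ℝ, E) x x)
        (vectorFieldInChart X x (extChartAt 𝓘(ℝ, E) x x))) w
    + christoffel g x (extChartAt 𝓘(ℝ, E) x x) (vectorFieldInChart X x (extChartAt 𝓘(ℝ, E) x x))
        (vectorFieldInChart X x (extChartAt 𝓘(ℝ, E) x x)) w

lemma oneFormInChart_metric
    (g : Π x : M, TangentSpace 𝓘(ℝ, E) x →L[ℝ] TangentSpace 𝓘(ℝ, E) x →L[ℝ] ℝ)
    (X : Π x : M, TangentSpace 𝓘(ℝ, E) x) {x₀ : M} {y : E}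
    (hy : y ∈ (extChartAt 𝓘(ℝ, E) x₀).target) :
    metricInChart g x₀ y (vectorFieldInChart X x₀ y) =
      oneFormInChart (fun p ↦ g p (X p)) x₀ y := by
  ext w
  exact congrArg (fun u ↦ g ((extChartAt 𝓘(ℝ, E) x₀).symm y) u
    (mfderiv 𝓘(ℝ, E) 𝓘(ℝ, E) (extChartAt 𝓘(ℝ, E) x₀).symm y w))
    (mfderiv_symm_vectorFieldInChart X hy)

lemma loweredAcceleration_eq_extD
    {g : Π x : M, TangentSpace 𝓘(ℝ, E) x →L[ℝ] TangentSpace 𝓘(ℝ, E) x →L[ℝ] ℝ}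
    {X : Π x : M, TangentSpace 𝓘(ℝ, E) x} {x : M}
    (hg : DifferentiableAt ℝ (metricInChart g x) (extChartAt 𝓘(ℝ, E) x x))
    (hX : DifferentiableAt ℝ (vectorFieldInChart X x) (extChartAt 𝓘(ℝ, E) x x))
    (hsymm : ∀ v w, g x v w = g x w v) (hunit : ∀ p, g p (X p) (X p) = 1)
    (w : TangentSpace 𝓘(ℝ, E) x) :
    loweredAcceleration g X x w = extD (fun p ↦ g p (X p)) x ![X x, w] := by
  have h0 : (fun y ↦ metricInChart g x y (vectorFieldInChart X x y))
      =ᶠ[𝓝 (extChartAt 𝓘(ℝ, E) x x)] oneFormInChart (fun p ↦ g p (X p)) x := by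
    filter_upwards [eventually_mem_target x] with y hy
    exact oneFormInChart_metric g X hy
  have h1 : DifferentiableAt ℝ (oneFormInChart (fun p ↦ g p (X p)) x)
      (extChartAt 𝓘(ℝ, E) x x) := (hg.clm_apply hX).congr_of_eventuallyEq h0.symm
  refine Eq.trans ?_ (extD_apply h1 (X x) w).symm
  rw [← vectorFieldInChart_self X x, ← h0.fderiv_eq]
  refine acceleration_eq_of_unit hg hX (fun v w ↦ ?_) ?_ w
  · rw [metricInChart_self, metricInChart_self]; exact hsymm v w
  · filter_upwards [eventually_mem_target x] with y hy
    rw [oneFormInChart_metric g X hy, oneFormInChart_vectorFieldInChart _ _ hy, hunit]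

/-- If `g(Z, ·) = e^{2h} τ` with `τ(Z) = 1`, then the acceleration of the unit vector field
`X = e^{-h} Z` is `L_Z τ - dh + dh(Z) τ`. -/
lemma loweredAcceleration_eq {τ : Π x : M, TangentSpace 𝓘(ℝ, E) x →L[ℝ] ℝ}
    (hτ : IsSmoothOneForm τ) {Z : Π x : M, TangentSpace 𝓘(ℝ, E) x} (hZ : IsSmoothVectorField Z)
    (hτZ : ∀ x, τ x (Z x) = 1)
    {g : Π x : M, TangentSpace 𝓘(ℝ, E) x →L[ℝ] TangentSpace 𝓘(ℝ, E) x →L[ℝ] ℝ}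
    {h : M → ℝ} (hh : ContMDiff 𝓘(ℝ, E) 𝓘(ℝ, ℝ) ∞ h)
    (hgZ : ∀ x v, g x (Z x) v = Real.exp (2 * h x) * τ x v) {x : M}
    (hg : DifferentiableAt ℝ (metricInChart g x) (extChartAt 𝓘(ℝ, E) x x))
    (hX : DifferentiableAt ℝ (vectorFieldInChart (fun p ↦ Real.exp (-h p) • Z p) x)
      (extChartAt 𝓘(ℝ, E) x x))
    (hsymm : ∀ v w, g x v w = g x w v) (w : TangentSpace 𝓘(ℝ, E) x) :
    loweredAcceleration g (fun p ↦ Real.exp (-h p) • Z p) x w =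
      lieDerivOneForm Z τ x w - diffForm h x w + diffForm h x (Z x) * τ x w := by
  have hg1 : (fun p ↦ g p (Real.exp (-h p) • Z p)) = fun p ↦ Real.exp (h p) • τ p := by
    funext p
    ext v
    rw [map_smul, smul_apply, hgZ, smul_apply, smul_eq_mul, smul_eq_mul,
      ← mul_assoc, ← Real.exp_add]
    congr 2
    ring
  have hmd := hh.mdifferentiableAt (x := x) (by simp)
  rw [loweredAcceleration_eq_extD hg hX hsymm, hg1]
  · have he : ContMDiffAt 𝓘(ℝ, E) 𝓘(ℝ, ℝ) ∞ (fun p ↦ Real.exp (h p)) x :=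
      Real.contDiff_exp.contMDiff.contMDiffAt.comp x hh.contMDiffAt
    have h1 := extD_smul_apply he ((hτ.contDiffAt
      (mem_extChartAt_source x)).differentiableAt (by simp)) (Z x) w
    have hcons : (![Real.exp (-h x) • Z x, w] : Fin 2 → TangentSpace 𝓘(ℝ, E) x) =
        Function.update ![Z x, w] 0 (Real.exp (-h x) • (![Z x, w] : Fin 2 → _) 0) := by
      ext i; fin_cases i <;> simp
    refine (congrArg (extD (fun p ↦ Real.exp (h p) • τ p) x) hcons).trans ?_
    rw [ContinuousAlternatingMap.map_update_smul, Function.update_eq_self]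
    refine (congrArg (fun r ↦ Real.exp (-h x) • r) h1).trans ?_
    rw [diffForm_exp hmd (Z x), diffForm_exp hmd w, lieDerivOneForm_apply hτ hZ hτZ, hτZ,
      smul_eq_mul]
    have h2 : Real.exp (-h x) * Real.exp (h x) = 1 := by rw [← Real.exp_add]; simp
    linear_combination (diffForm h x (Z x) * τ x w - diffForm h x w + extD τ x ![Z x, w]) * h2
  · intro p
    rw [congrFun hg1 p, smul_apply, map_smul, hτZ, smul_eq_mul, smul_eq_mul, mul_one,
      ← Real.exp_add]
    simp

end Charts

end

section

/-- The real numbers with the discrete topology. -/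
def DiscreteReal : Type := ℝ

instance : TopologicalSpace DiscreteReal := ⊥

instance : DiscreteTopology DiscreteReal := ⟨rfl⟩

/-- Translation by a real number. -/
def DiscreteReal.shift (c : DiscreteReal) (r : ℝ) : DiscreteReal :=
  (show ℝ from c) + r

section Glue

variable {M : Type*} [TopologicalSpace M]

/-- The bundle with discrete fibres whose sections are the functions which differ locally from the
given local functions by constants. -/
def primitiveCore (U : M → Set M) (hU : ∀ x, IsOpen (U x)) (hxU : ∀ x, x ∈ U x) (f : M → M → ℝ)
    (hf : ∀ i j, ∀ x ∈ U i ∩ U j, ∀ᶠ z in 𝓝 x, f i z - f j z = f i x - f j x) :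
    FiberBundleCore M M DiscreteReal where
  baseSet := U
  isOpen_baseSet := hU
  indexAt := id
  mem_baseSet_at := hxU
  coordChange i j x c := c.shift (f i x - f j x)
  coordChange_self i x _ v := by
    rw [sub_self]
    exact add_zero (show ℝ from v)
  continuousOn_coordChange i j := by
    rintro ⟨x, c⟩ ⟨hx, -⟩
    refine ContinuousAt.continuousWithinAt ?_
    have h : (fun p : M × DiscreteReal ↦ p.2.shift (f i p.1 - f j p.1))
        =ᶠ[𝓝 (x, c)] fun _ ↦ c.shift (f i x - f j x) := by
      rw [nhds_prod_eq, nhds_discrete DiscreteReal, Filter.prod_pure]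
      refine Filter.eventually_map.2 ?_
      filter_upwards [hf i j x hx] with z hz
      exact congrArg c.shift hz
    exact continuousAt_const.congr h.symm
  coordChange_comp i j k x _ v := by
    change (show ℝ from v) + (f i x - f j x) + (f j x - f k x) = (show ℝ from v) + (f i x - f k x)
    ring

/-- On a simply connected space, functions on the sets of an open cover whose differences are
locally constant come, up to locally constant functions, from a global function. -/
lemma exists_forall_eventually_sub_eq [SimplyConnectedSpace M] [LocallyPathConnectedSpace M]
    (U : M → Set M) (hU : ∀ x, IsOpen (U x)) (hxU : ∀ x, x ∈ U x) (f : M → M → ℝ)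
    (hf : ∀ i j, ∀ x ∈ U i ∩ U j, ∀ᶠ z in 𝓝 x, f i z - f j z = f i x - f j x) :
    ∃ h : M → ℝ, ∀ x, ∀ᶠ z in 𝓝 x, h z - f x z = h x - f x x := by
  let C := primitiveCore U hU hxU f hf
  obtain ⟨a₀⟩ : Nonempty M := inferInstance
  have hcov : IsCoveringMap C.proj := FiberBundle.isCoveringMap (F := DiscreteReal) (E := C.Fiber)
  obtain ⟨s, ⟨-, hs⟩, -⟩ := hcov.existsUnique_continuousMap_lifts (ContinuousMap.id M) a₀
    (⟨a₀, (0 : ℝ)⟩ : C.TotalSpace) rfl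
  have hs1 (x : M) : (s x).1 = x := congrFun hs x
  let c : M → ℝ := fun x ↦ (s x).2
  refine ⟨fun x ↦ c x + f x x, fun x ↦ ?_⟩
  have hcont : ContinuousAt (fun z ↦ (C.localTriv x (s z)).2) x := by
    have hmem : s x ∈ (C.localTriv x).source := by
      rw [C.mem_localTriv_source, hs1]
      exact hxU x
    exact continuous_snd.continuousAt.comp
      (ContinuousAt.comp (f := s) ((C.localTriv x).continuousAt hmem) s.continuous.continuousAt)
  have h1 := hcont.eventually_mem (s := {(C.localTriv x (s x)).2})
    ((isOpen_discrete _).mem_nhds rfl)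
  have h2 (z : M) : (C.localTriv x (s z)).2 = (c z + (f z z - f x z) : ℝ) := by
    rw [C.localTriv_apply]
    change c z + (f (s z).1 (s z).1 - f x (s z).1) = _
    rw [hs1]
  filter_upwards [h1] with z hz
  have h3 : (c z + (f z z - f x z) : ℝ) = (c x + (f x x - f x x) : ℝ) :=
    (h2 z).symm.trans ((Set.mem_singleton_iff.1 hz).trans (h2 x))
  linarith

end Glue

variable {E : Type*} [NormedAddCommGroup E] [NormedSpace ℝ E]
  {M : Type*} [TopologicalSpace M] [ChartedSpace E M] [IsManifold 𝓘(ℝ, E) ∞ M]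

/-- A function with vanishing differential on an open set is locally constant there. -/
lemma eventually_eq_of_hasMFDerivAt_zero {k : M → ℝ} {W : Set M} (hW : IsOpen W)
    (hk : ∀ x ∈ W, HasMFDerivAt 𝓘(ℝ, E) 𝓘(ℝ, ℝ) k x 0) {x : M} (hx : x ∈ W) :
    ∀ᶠ z in 𝓝 x, k z = k x := by
  have hmem : ∀ᶠ y in 𝓝 (extChartAt 𝓘(ℝ, E) x x), y ∈ (extChartAt 𝓘(ℝ, E) x).target ∧
      (extChartAt 𝓘(ℝ, E) x).symm y ∈ W := by
    refine (eventually_mem_target x).and ?_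
    refine (contMDiffAt_extChartAt_symm (mem_extChartAt_target x)).continuousAt.eventually_mem ?_
    rw [extChartAt_to_inv]
    exact hW.mem_nhds hx
  obtain ⟨r, hr, hball⟩ := Metric.eventually_nhds_iff_ball.1 hmem
  have hd : ∀ y ∈ Metric.ball (extChartAt 𝓘(ℝ, E) x x) r,
      HasFDerivAt (fun y ↦ k ((extChartAt 𝓘(ℝ, E) x).symm y)) (0 : E →L[ℝ] ℝ) y := by
    intro y hy
    have h1 := (hk _ (hball y hy).2).comp y
      ((contMDiffAt_extChartAt_symm (hball y hy).1).mdifferentiableAt (by simp)).hasMFDerivAt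
    rw [ContinuousLinearMap.zero_comp] at h1
    exact h1.hasFDerivAt
  have hc := extChartAt_source_mem_nhds (I := 𝓘(ℝ, E)) x
  have hc2 := (continuousAt_extChartAt (I := 𝓘(ℝ, E)) x).eventually_mem (Metric.ball_mem_nhds _ hr)
  filter_upwards [hc, hc2] with z hz hz2
  have h3 := (convex_ball (extChartAt 𝓘(ℝ, E) x x) r).is_const_of_fderivWithin_eq_zero (𝕜 := ℝ)
    (fun y hy ↦ (hd y hy).differentiableAt.differentiableWithinAt)
    (fun y hy ↦ (hd y hy).hasFDerivWithinAt.fderivWithin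
      (Metric.isOpen_ball.uniqueDiffWithinAt hy)) hz2 (Metric.mem_ball_self hr)
  simpa only [(extChartAt 𝓘(ℝ, E) x).left_inv hz, extChartAt_to_inv] using h3

/-- Closed one-forms have local primitives. -/
lemma exists_local_primitive {α : Π x : M, TangentSpace 𝓘(ℝ, E) x →L[ℝ] ℝ}
    (hα : IsSmoothOneForm α) (hdα : ∀ x, extD α x = 0) (x₀ : M) :
    ∃ U : Set M, IsOpen U ∧ x₀ ∈ U ∧ ∃ f : M → ℝ,
      ∀ x ∈ U, HasMFDerivAt 𝓘(ℝ, E) 𝓘(ℝ, ℝ) f x (α x) := by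
  obtain ⟨r, hr, hball⟩ := Metric.eventually_nhds_iff_ball.1 (eventually_mem_target (E := E) x₀)
  have hsm : ∀ y ∈ Metric.ball (extChartAt 𝓘(ℝ, E) x₀ x₀) r,
      DifferentiableAt ℝ (oneFormInChart α x₀) y := by
    intro y hy
    have h := hα.contDiffAt ((extChartAt 𝓘(ℝ, E) x₀).map_target (hball y hy))
    rw [(extChartAt 𝓘(ℝ, E) x₀).right_inv (hball y hy)] at h
    exact h.differentiableAt (by simp)
  obtain ⟨f, hf⟩ := (convex_ball (extChartAt 𝓘(ℝ, E) x₀ x₀)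
    r).exists_forall_hasFDerivAt_of_fderiv_symmetric Metric.isOpen_ball
    (fun y hy ↦ (hsm y hy).differentiableWithinAt) (by
      intro y hy v w
      have hyt := hball y hy
      have hinv := (extChartAt 𝓘(ℝ, E) x₀).right_inv hyt
      have h := extD_apply_of_mem (α := α) ((extChartAt 𝓘(ℝ, E) x₀).map_target hyt)
        (by rw [hinv]; exact hsm y hy)
        (mfderiv 𝓘(ℝ, E) 𝓘(ℝ, E) (extChartAt 𝓘(ℝ, E) x₀).symm y v)
        (mfderiv 𝓘(ℝ, E) 𝓘(ℝ, E) (extChartAt 𝓘(ℝ, E) x₀).symm y w)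
      rw [mfderiv_extChartAt_mfderiv_symm hyt, mfderiv_extChartAt_mfderiv_symm hyt, hinv,
        hdα] at h
      exact (sub_eq_zero.1 h.symm))
  refine ⟨(extChartAt 𝓘(ℝ, E) x₀).source ∩ extChartAt 𝓘(ℝ, E) x₀ ⁻¹'
      Metric.ball (extChartAt 𝓘(ℝ, E) x₀ x₀) r,
    isOpen_extChartAt_preimage' x₀ Metric.isOpen_ball, ?_, fun x ↦ f (extChartAt 𝓘(ℝ, E) x₀ x), ?_⟩
  · exact ⟨mem_extChartAt_source x₀, Metric.mem_ball_self hr⟩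
  · rintro x ⟨hx, hxb⟩
    have h1 := (hf _ hxb).hasMFDerivAt.comp x
      ((contMDiffAt_extChartAt_of_mem hx).mdifferentiableAt (by simp)).hasMFDerivAt
    have h3 : α x = (oneFormInChart α x₀ (extChartAt 𝓘(ℝ, E) x₀ x)).comp
        (mfderiv 𝓘(ℝ, E) 𝓘(ℝ, E) (extChartAt 𝓘(ℝ, E) x₀) x) := ?_
    · rw [h3]; exact h1
    ext v
    have h2 := congrArg (α x) (mfderiv_extChartAt_symm_mfderiv hx v)
    refine h2.symm.trans ?_
    change _ = oneFormInChart α x₀ (extChartAt 𝓘(ℝ, E) x₀ x)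
      (mfderiv 𝓘(ℝ, E) 𝓘(ℝ, E) (extChartAt 𝓘(ℝ, E) x₀) x v)
    unfold oneFormInChart
    rw [(extChartAt 𝓘(ℝ, E) x₀).left_inv hx]
    rfl

lemma contMDiff_of_hasMFDerivAt {α : Π x : M, TangentSpace 𝓘(ℝ, E) x →L[ℝ] ℝ}
    (hα : IsSmoothOneForm α) {h : M → ℝ} (hh : ∀ x, HasMFDerivAt 𝓘(ℝ, E) 𝓘(ℝ, ℝ) h x (α x)) :
    ContMDiff 𝓘(ℝ, E) 𝓘(ℝ, ℝ) ∞ h := by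
  intro x
  rw [contMDiffAt_iff_comp_symm (mem_extChartAt_source x)]
  have hopen := isOpen_extChartAt_target (I := 𝓘(ℝ, E)) x
  have hd : ∀ y ∈ (extChartAt 𝓘(ℝ, E) x).target,
      HasFDerivAt (fun y ↦ h ((extChartAt 𝓘(ℝ, E) x).symm y)) (oneFormInChart α x y) y := by
    intro y hy
    exact ((hh _).comp y ((contMDiffAt_extChartAt_symm hy).mdifferentiableAt
      (by simp)).hasMFDerivAt).hasFDerivAt
  have h1 : ContDiffOn ℝ ∞ (fun y ↦ h ((extChartAt 𝓘(ℝ, E) x).symm y))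
      (extChartAt 𝓘(ℝ, E) x).target := by
    rw [contDiffOn_infty_iff_fderiv_of_isOpen hopen]
    refine ⟨fun y hy ↦ (hd y hy).differentiableAt.differentiableWithinAt, fun y hy ↦ ?_⟩
    have h2 := hα.contDiffAt ((extChartAt 𝓘(ℝ, E) x).map_target hy)
    rw [(extChartAt 𝓘(ℝ, E) x).right_inv hy] at h2
    refine (h2.congr_of_eventuallyEq ?_).contDiffWithinAt
    filter_upwards [hopen.mem_nhds hy] with z hz
    exact (hd z hz).fderiv
  exact h1.contDiffAt (hopen.mem_nhds (mem_extChartAt_target x))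

/-- On a simply connected manifold, closed one-forms are exact. -/
theorem exists_diffForm_eq [SimplyConnectedSpace M]
    {α : Π x : M, TangentSpace 𝓘(ℝ, E) x →L[ℝ] ℝ}
    (hα : IsSmoothOneForm α) (hdα : ∀ x, extD α x = 0) :
    ∃ h : M → ℝ, ContMDiff 𝓘(ℝ, E) 𝓘(ℝ, ℝ) ∞ h ∧ ∀ x, diffForm h x = α x := by
  have : LocallyPathConnectedSpace M := ChartedSpace.locallyPathConnectedSpace E M
  choose U hU hxU f hf using exists_local_primitive hα hdα
  obtain ⟨h, hh⟩ := exists_forall_eventually_sub_eq U hU hxU f (by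
    rintro i j x hx
    refine eventually_eq_of_hasMFDerivAt_zero (E := E) (k := fun z ↦ f i z - f j z)
      ((hU i).inter (hU j)) (fun z hz ↦ ?_) hx
    have h1 := (hf i z hz.1).sub (hf j z hz.2)
    rw [sub_self] at h1
    exact h1)
  have hd : ∀ x, HasMFDerivAt 𝓘(ℝ, E) 𝓘(ℝ, ℝ) h x (α x) := by
    intro x
    have h1 := (hf x x (hxU x)).add
      (hasMFDerivAt_const (I := 𝓘(ℝ, E)) (I' := 𝓘(ℝ, ℝ)) (h x - f x x) x)
    have h2 : HasMFDerivAt 𝓘(ℝ, E) 𝓘(ℝ, ℝ) (f x + fun _ ↦ h x - f x x) x (α x) := by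
      rw [show α x = α x + 0 from (add_zero _).symm]
      exact h1
    refine h2.congr_of_eventuallyEq ?_
    filter_upwards [hh x] with z hz
    change h z = f x z + (h x - f x x)
    linarith
  exact ⟨h, contMDiff_of_hasMFDerivAt hα hd, fun x ↦ (hd x).mfderiv⟩

end

section

variable {E : Type*} [NormedAddCommGroup E] [NormedSpace ℝ E]
  {M : Type*} [TopologicalSpace M] [ChartedSpace E M]

lemma extD_eq_zero_iff {α : Π x : M, TangentSpace 𝓘(ℝ, E) x →L[ℝ] ℝ} {x : M} :
    extD α x = 0 ↔ ∀ v w : TangentSpace 𝓘(ℝ, E) x, extD α x ![v, w] = 0 := by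
  refine ⟨fun h v w ↦ by rw [h]; rfl, fun h ↦ ?_⟩
  ext m
  have hm : m = ![m 0, m 1] := by ext i; fin_cases i <;> rfl
  rw [hm, h]
  rfl

variable [IsManifold 𝓘(ℝ, E) ∞ M]

lemma isSmoothOneForm_iff {α : Π x : M, TangentSpace 𝓘(ℝ, E) x →L[ℝ] ℝ} :
    IsSmoothOneForm α ↔
      ∀ x, ContDiffAt ℝ ∞ (oneFormInChart α x) (extChartAt 𝓘(ℝ, E) x x) :=
  forall_congr' fun x ↦ contMDiffAt_oneForm_iff α (mem_extChartAt_source x)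

lemma IsSmoothOneForm.smul {u : M → ℝ} (hu : ContMDiff 𝓘(ℝ, E) 𝓘(ℝ, ℝ) ∞ u)
    {α : Π x : M, TangentSpace 𝓘(ℝ, E) x →L[ℝ] ℝ} (hα : IsSmoothOneForm α) :
    IsSmoothOneForm (fun p ↦ u p • α p) := by
  rw [isSmoothOneForm_iff]
  intro x
  rw [oneFormInChart_smul]
  exact ((contMDiffAt_iff_comp_symm (mem_extChartAt_source x)).1 hu.contMDiffAt).smul
    (hα.contDiffAt (mem_extChartAt_source x))

lemma IsSmoothOneForm.add {α β : Π x : M, TangentSpace 𝓘(ℝ, E) x →L[ℝ] ℝ}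
    (hα : IsSmoothOneForm α) (hβ : IsSmoothOneForm β) : IsSmoothOneForm (fun p ↦ α p + β p) := by
  rw [isSmoothOneForm_iff]
  intro x
  rw [oneFormInChart_add]
  exact (hα.contDiffAt (mem_extChartAt_source x)).add (hβ.contDiffAt (mem_extChartAt_source x))

lemma isSmoothOneForm_diffForm {h : M → ℝ} (hh : ContMDiff 𝓘(ℝ, E) 𝓘(ℝ, ℝ) ∞ h) :
    IsSmoothOneForm (E := E) (diffForm h) :=
  isSmoothOneForm_iff.2 fun x ↦
    contDiffAt_oneFormInChart_diffForm hh (mem_extChartAt_source x)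

lemma IsSmoothOneForm.contMDiff_apply {α : Π x : M, TangentSpace 𝓘(ℝ, E) x →L[ℝ] ℝ}
    (hα : IsSmoothOneForm α) {X : Π x : M, TangentSpace 𝓘(ℝ, E) x} (hX : IsSmoothVectorField X) :
    ContMDiff 𝓘(ℝ, E) 𝓘(ℝ, ℝ) ∞ (fun x ↦ α x (X x)) := by
  intro x
  rw [contMDiffAt_iff_comp_symm (mem_extChartAt_source x)]
  refine ((hα.contDiffAt (mem_extChartAt_source x)).clm_apply
    (hX.contDiffAt (mem_extChartAt_source x))).congr_of_eventuallyEq ?_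
  filter_upwards [eventually_mem_target x] with y hy
  rw [oneFormInChart_vectorFieldInChart α X hy]

/-- The exterior derivative on vectors given in the chart at `x₀`. -/
lemma extD_apply_mfderiv_symm {α : Π x : M, TangentSpace 𝓘(ℝ, E) x →L[ℝ] ℝ}
    (hα : IsSmoothOneForm α) {x₀ : M} {y : E} (hy : y ∈ (extChartAt 𝓘(ℝ, E) x₀).target)
    (v w : E) :
    extD α ((extChartAt 𝓘(ℝ, E) x₀).symm y)
      ![mfderiv 𝓘(ℝ, E) 𝓘(ℝ, E) (extChartAt 𝓘(ℝ, E) x₀).symm y v,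
        mfderiv 𝓘(ℝ, E) 𝓘(ℝ, E) (extChartAt 𝓘(ℝ, E) x₀).symm y w] =
      fderiv ℝ (oneFormInChart α x₀) y v w - fderiv ℝ (oneFormInChart α x₀) y w v := by
  have hx := (extChartAt 𝓘(ℝ, E) x₀).map_target hy
  have h := extD_apply_of_mem (α := α) hx ((hα.contDiffAt hx).differentiableAt (by simp))
    (mfderiv 𝓘(ℝ, E) 𝓘(ℝ, E) (extChartAt 𝓘(ℝ, E) x₀).symm y v)
    (mfderiv 𝓘(ℝ, E) 𝓘(ℝ, E) (extChartAt 𝓘(ℝ, E) x₀).symm y w)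
  rwa [mfderiv_extChartAt_mfderiv_symm hy, mfderiv_extChartAt_mfderiv_symm hy,
    (extChartAt 𝓘(ℝ, E) x₀).right_inv hy] at h

lemma isSmoothOneForm_lieDerivOneForm {Z : Π x : M, TangentSpace 𝓘(ℝ, E) x}
    {τ : Π x : M, TangentSpace 𝓘(ℝ, E) x →L[ℝ] ℝ} (hτ : IsSmoothOneForm τ)
    (hZ : IsSmoothVectorField Z) {c : ℝ} (hτZ : ∀ x, τ x (Z x) = c) :
    IsSmoothOneForm (lieDerivOneForm Z τ) := by
  rw [isSmoothOneForm_iff]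
  intro x
  have h1 := (hτ.contDiffAt (mem_extChartAt_source x)).fderiv_right (m := ∞) (by simp)
  have h2 := hZ.contDiffAt (mem_extChartAt_source x)
  have happly : ContDiff ℝ ∞
      (fun v : E ↦ (ContinuousLinearMap.apply ℝ ℝ v : (E →L[ℝ] ℝ) →L[ℝ] ℝ)) := by fun_prop
  have h3 : ContDiffAt ℝ ∞ (fun y ↦ ContinuousLinearMap.apply ℝ ℝ (vectorFieldInChart Z x y))
      (extChartAt 𝓘(ℝ, E) x x) :=
    happly.contDiffAt.comp _ h2
  refine ((h1.clm_apply h2).sub (h3.clm_comp h1)).congr_of_eventuallyEq ?_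
  filter_upwards [eventually_mem_target x] with y hy
  ext w
  have h4 := extD_apply_mfderiv_symm hτ hy (vectorFieldInChart Z x y) w
  refine Eq.trans ?_ h4
  rw [mfderiv_symm_vectorFieldInChart Z hy]
  exact lieDerivOneForm_apply hτ hZ hτZ _ _

lemma contMDiff_evalBivector {α : Π x : M, TangentSpace 𝓘(ℝ, E) x →L[ℝ] ℝ}
    (hα : IsSmoothOneForm α) {D : Π x : M, Submodule ℝ (TangentSpace 𝓘(ℝ, E) x)}
    {χ : Π x : M, ⋀[ℝ]^2 (TangentSpace 𝓘(ℝ, E) x)} (hχ : IsSmoothBivectorField D χ) :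
    ContMDiff 𝓘(ℝ, E) 𝓘(ℝ, ℝ) ∞ (fun x ↦ evalBivector (extD α x) (χ x)) := by
  intro x
  obtain ⟨U, hU, hxU, k, X, Y, hXY, -, hsum⟩ := hχ x
  rw [contMDiffAt_iff_comp_symm (mem_extChartAt_source x)]
  have h1 := (hα.contDiffAt (mem_extChartAt_source x)).fderiv_right (m := ∞) (by simp)
  have hX (i : Fin k) := (hXY i).1.contDiffAt (hU.mem_nhds hxU) (mem_extChartAt_source x)
  have hY (i : Fin k) := (hXY i).2.contDiffAt (hU.mem_nhds hxU) (mem_extChartAt_source x)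
  have h2 : ContDiffAt ℝ ∞ (fun y ↦ ∑ i,
      (fderiv ℝ (oneFormInChart α x) y (vectorFieldInChart (X i) x y) (vectorFieldInChart (Y i) x y)
        - fderiv ℝ (oneFormInChart α x) y (vectorFieldInChart (Y i) x y)
          (vectorFieldInChart (X i) x y))) (extChartAt 𝓘(ℝ, E) x x) :=
    ContDiffAt.sum fun i _ ↦ ((h1.clm_apply (hX i)).clm_apply (hY i)).sub
      ((h1.clm_apply (hY i)).clm_apply (hX i))
  refine h2.congr_of_eventuallyEq ?_
  have hev : ∀ᶠ y in 𝓝 (extChartAt 𝓘(ℝ, E) x x), (extChartAt 𝓘(ℝ, E) x).symm y ∈ U := by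
    refine (contMDiffAt_extChartAt_symm (mem_extChartAt_target x)).continuousAt.eventually_mem ?_
    rw [extChartAt_to_inv]
    exact hU.mem_nhds hxU
  filter_upwards [eventually_mem_target x, hev] with y hy hyU
  rw [hsum _ hyU, evalBivector_sum]
  refine Finset.sum_congr rfl fun i _ ↦ ?_
  rw [← extD_apply_mfderiv_symm hα hy, mfderiv_symm_vectorFieldInChart (X i) hy,
    mfderiv_symm_vectorFieldInChart (Y i) hy]

/-- The condition `d_{τ ⊗ χ} L_Z τ = 0` means that `L_Z τ = dh - dh(Z) τ` for some function `h`. -/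
theorem dSelector_lieDerivOneForm_eq_zero_iff [SimplyConnectedSpace M]
    {τ : Π x : M, TangentSpace 𝓘(ℝ, E) x →L[ℝ] ℝ} (hτ : IsSmoothOneForm τ)
    {Z : Π x : M, TangentSpace 𝓘(ℝ, E) x} (hZ : IsSmoothVectorField Z)
    (hτZ : ∀ x, τ x (Z x) = 1)
    {χ : Π x : M, ⋀[ℝ]^2 (TangentSpace 𝓘(ℝ, E) x)}
    (hχ : IsSmoothBivectorField (kerForm τ) χ)
    (hdτχ : ∀ x, evalBivector (extD τ x) (χ x) = -1) :
    (∀ x, dSelector τ χ (lieDerivOneForm Z τ) x = 0) ↔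
      ∃ h : M → ℝ, ContMDiff 𝓘(ℝ, E) 𝓘(ℝ, ℝ) ∞ h ∧
        ∀ x w, lieDerivOneForm Z τ x w = diffForm h x w - diffForm h x (Z x) * τ x w := by
  have hβ := isSmoothOneForm_lieDerivOneForm hτ hZ hτZ
  have hu := contMDiff_evalBivector hβ hχ
  constructor
  · intro hd
    obtain ⟨h, hh, hdh⟩ := exists_diffForm_eq (hβ.add (hτ.smul hu)) hd
    refine ⟨h, hh, fun x w ↦ ?_⟩
    have h0 : lieDerivOneForm Z τ x (Z x) = 0 := by
      rw [lieDerivOneForm_apply hτ hZ hτZ]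
      exact (extD τ x).map_eq_zero_of_eq _ (i := 0) (j := 1) rfl (by simp)
    have h1 := DFunLike.congr_fun (hdh x) w
    have h2 := DFunLike.congr_fun (hdh x) (Z x)
    simp only [add_apply, smul_apply, smul_eq_mul, h0, hτZ] at h1 h2
    rw [h1, h2]
    ring
  · rintro ⟨h, hh, hβh⟩
    have hv : ContMDiff 𝓘(ℝ, E) 𝓘(ℝ, ℝ) ∞ (fun p ↦ -diffForm h p (Z p)) :=
      ((isSmoothOneForm_diffForm hh).contMDiff_apply hZ).neg
    have hβ' : lieDerivOneForm Z τ = fun p ↦ diffForm h p + (-diffForm h p (Z p)) • τ p := by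
      funext p
      ext w
      rw [hβh]
      simp only [add_apply, smul_apply, smul_eq_mul]
      ring
    have hdβ (x : M) (v w : TangentSpace 𝓘(ℝ, E) x) (hv0 : τ x v = 0) (hw0 : τ x w = 0) :
        extD (lieDerivOneForm Z τ) x ![v, w] = -diffForm h x (Z x) * extD τ x ![v, w] := by
      have hmem := mem_extChartAt_source (I := 𝓘(ℝ, E)) x
      have h1 := extD_add_apply
        (((isSmoothOneForm_diffForm (E := E) hh).contDiffAt hmem).differentiableAt (by simp))
        (((hτ.smul hv).contDiffAt hmem).differentiableAt (by simp)) v w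
      have h2 := extD_smul_apply hv.contMDiffAt
        ((hτ.contDiffAt hmem).differentiableAt (by simp)) v w
      have h3 := extD_diffForm hh x v w
      rw [hβ']
      refine h1.trans ?_
      rw [h3, h2]
      refine Eq.trans (b := 0 + (diffForm (fun p ↦ -diffForm h p (Z p)) x v * τ x w -
        diffForm (fun p ↦ -diffForm h p (Z p)) x w * τ x v +
        -diffForm h x (Z x) * extD τ x ![v, w])) rfl ?_
      rw [hv0, hw0]
      ring
    have hχβ (x : M) : evalBivector (extD (lieDerivOneForm Z τ) x) (χ x) = diffForm h x (Z x) := by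
      obtain ⟨U, -, hxU, k, X, Y, -, hD, hsum⟩ := hχ x
      have h1 := hdτχ x
      rw [hsum x hxU, evalBivector_sum] at h1 ⊢
      rw [Finset.sum_congr rfl fun i _ ↦ hdβ x (X i x) (Y i x) (hD i x hxU).1 (hD i x hxU).2,
        ← Finset.mul_sum, h1]
      ring
    intro x
    unfold dSelector
    have h1 : (fun p ↦ lieDerivOneForm Z τ p +
        contraction τ χ (extD (lieDerivOneForm Z τ)) p) = diffForm h := by
      funext p
      ext w
      rw [add_apply, hβh]
      unfold contraction
      rw [hχβ, smul_apply, smul_eq_mul]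
      ring
    rw [h1, extD_eq_zero_iff]
    exact fun v w ↦ extD_diffForm hh x v w

end

section

variable {E : Type*} [NormedAddCommGroup E] [NormedSpace ℝ E] [FiniteDimensional ℝ E]
  {M : Type*} [TopologicalSpace M] [ChartedSpace E M] [IsManifold 𝓘(ℝ, E) ∞ M]

lemma contDiffOn_bilin_of_apply {G : E → E →L[ℝ] E →L[ℝ] ℝ} {s : Set E}
    (hG : ∀ v w, ContDiffOn ℝ ∞ (fun z ↦ G z v w) s) : ContDiffOn ℝ ∞ G s :=
  contDiffOn_clm_apply.2 fun v ↦ contDiffOn_clm_apply.2 (hG v)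

lemma isVonNBounded_of_pos (b : E →L[ℝ] E →L[ℝ] ℝ) (hb : ∀ v, v ≠ 0 → 0 < b v v) :
    Bornology.IsVonNBounded ℝ {v : E | b v v < 1} := by
  obtain ⟨c, hc, hcb⟩ : ∃ c > 0, ∀ v ∈ Metric.sphere (0 : E) 1, c ≤ b v v := by
    rcases (Metric.sphere (0 : E) 1).eq_empty_or_nonempty with h | h
    · exact ⟨1, one_pos, by simp [h]⟩
    · have hcont : ContinuousOn (fun v ↦ b v v) (Metric.sphere (0 : E) 1) :=
        (b.continuous.clm_apply continuous_id).continuousOn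
      obtain ⟨u, hu, hmin⟩ := (isCompact_sphere (0 : E) 1).exists_isMinOn h hcont
      exact ⟨b u u, hb u (by rintro rfl; simp at hu), fun v hv ↦ hmin hv⟩
  rw [NormedSpace.isVonNBounded_iff, isBounded_iff_forall_norm_le]
  refine ⟨c⁻¹ + 1, fun v hv ↦ ?_⟩
  have hv1 : b v v < 1 := hv
  have h2 : c * ‖v‖ ^ 2 ≤ b v v := by
    rcases eq_or_ne v 0 with rfl | hv0
    · simp
    · have hn : ‖v‖ ≠ 0 := norm_ne_zero_iff.2 hv0
      have h3 := hcb (‖v‖⁻¹ • v) (by simp [norm_smul, hn])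
      simp only [map_smul, smul_apply, smul_eq_mul] at h3
      have h4 := mul_le_mul_of_nonneg_right h3 (sq_nonneg ‖v‖)
      have h5 : ‖v‖⁻¹ * (‖v‖⁻¹ * (b v) v) * ‖v‖ ^ 2 = b v v := by field_simp
      linarith
  have h3 : ‖v‖ ^ 2 ≤ c⁻¹ := by
    rw [← one_div, le_div_iff₀ hc]
    nlinarith
  nlinarith [sq_nonneg (‖v‖ - 1), norm_nonneg v]

/-- An inner product on a finite-dimensional space. -/
def euclideanForm (E : Type*) [NormedAddCommGroup E] [NormedSpace ℝ E] [FiniteDimensional ℝ E] :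
    E →L[ℝ] E →L[ℝ] ℝ :=
  pullbackBilin (innerSL ℝ) (toEuclidean (E := E)).toContinuousLinearMap

lemma euclideanForm_apply (v w : E) :
    euclideanForm E v w = inner ℝ (toEuclidean v) (toEuclidean w) :=
  rfl

lemma euclideanForm_symm (v w : E) : euclideanForm E v w = euclideanForm E w v := by
  rw [euclideanForm_apply, euclideanForm_apply, real_inner_comm]

lemma euclideanForm_nonneg (v : E) : 0 ≤ euclideanForm E v v := by
  rw [euclideanForm_apply]
  exact real_inner_self_nonneg

lemma euclideanForm_pos {v : E} (hv : v ≠ 0) : 0 < euclideanForm E v v := by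
  rw [euclideanForm_apply]
  exact real_inner_self_pos.2 (by simpa using hv)

lemma ContDiffAt.euclideanForm_apply {a b : E → E} {y : E} (ha : ContDiffAt ℝ ∞ a y)
    (hb : ContDiffAt ℝ ∞ b y) : ContDiffAt ℝ ∞ (fun z ↦ euclideanForm E (a z) (b z)) y :=
  ContDiffAt.inner ℝ (toEuclidean.contDiff.contDiffAt.comp y ha)
    (toEuclidean.contDiff.contDiffAt.comp y hb)

variable [T2Space M] [SigmaCompactSpace M]

set_option synthInstance.maxHeartbeats 400000 in
set_option maxHeartbeats 1000000 in
/-- There is a Riemannian metric with prescribed `g(Z, ·)`, if `g(Z, Z)` is positive. -/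
theorem exists_riemannianMetric_apply_eq {τ : Π x : M, TangentSpace 𝓘(ℝ, E) x →L[ℝ] ℝ}
    (hτ : IsSmoothOneForm τ) {Z : Π x : M, TangentSpace 𝓘(ℝ, E) x} (hZ : IsSmoothVectorField Z)
    (hτZ : ∀ x, τ x (Z x) = 1) {f : M → ℝ} (hf : ContMDiff 𝓘(ℝ, E) 𝓘(ℝ, ℝ) ∞ f)
    (hf0 : ∀ x, 0 < f x) :
    ∃ g : Bundle.ContMDiffRiemannianMetric 𝓘(ℝ, E) ∞ E (fun x : M ↦ TangentSpace 𝓘(ℝ, E) x),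
      ∀ x v, g.inner x (Z x) v = f x * τ x v := by
  let t (x : M) : Set (TangentSpace 𝓘(ℝ, E) x →L[ℝ] TangentSpace 𝓘(ℝ, E) x →L[ℝ] ℝ) :=
    {b | (∀ v w, b v w = b w v) ∧ (∀ v, v ≠ 0 → 0 < b v v) ∧ ∀ v, b (Z x) v = f x * τ x v}
  have ht (x : M) : Convex ℝ (t x) := by
    rintro b ⟨h1, h2, h3⟩ b' ⟨h1', h2', h3'⟩ p q hp hq hpq
    refine ⟨fun v w ↦ ?_, fun v hv ↦ ?_, fun v ↦ ?_⟩
    · simp only [add_apply, smul_apply, smul_eq_mul, h1 v w, h1' v w]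
    · simp only [add_apply, smul_apply, smul_eq_mul]
      rcases hp.eq_or_lt with rfl | hp
      · have : q = 1 := by linarith
        simpa [this] using h2' v hv
      · have := mul_pos hp (h2 v hv)
        have := mul_nonneg hq (h2' v hv).le
        linarith
    · simp only [add_apply, smul_apply, smul_eq_mul, h3, h3']
      rw [← add_mul, hpq, one_mul]
  obtain ⟨s, hs⟩ := exists_contMDiffSection_forall_mem_convex_of_local 𝓘(ℝ, E) (n := (⊤ : ℕ∞))
    (F_fiber := E →L[ℝ] E →L[ℝ] ℝ)
    (fun x : M ↦ TangentSpace 𝓘(ℝ, E) x →L[ℝ] TangentSpace 𝓘(ℝ, E) x →L[ℝ] ℝ) t ht (by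
      intro x₀
      let P (x : M) : TangentSpace 𝓘(ℝ, E) x →L[ℝ] TangentSpace 𝓘(ℝ, E) x :=
        ContinuousLinearMap.id ℝ _ - (τ x).smulRight (Z x)
      let A (x : M) : TangentSpace 𝓘(ℝ, E) x →L[ℝ] E :=
        mfderiv 𝓘(ℝ, E) 𝓘(ℝ, E) (extChartAt 𝓘(ℝ, E) x₀) x
      let s (x : M) : TangentSpace 𝓘(ℝ, E) x →L[ℝ] TangentSpace 𝓘(ℝ, E) x →L[ℝ] ℝ :=
        pullbackBilin (euclideanForm E) ((A x).comp (P x)) + (τ x).smulRight (f x • τ x)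
      have hs (x : M) (v w : TangentSpace 𝓘(ℝ, E) x) : s x v w =
          euclideanForm E (A x (v - τ x v • Z x)) (A x (w - τ x w • Z x))
            + τ x v * (f x * τ x w) := rfl
      refine ⟨(extChartAt 𝓘(ℝ, E) x₀).source, extChartAt_source_mem_nhds x₀, s, ?_, ?_⟩
      · intro x hx
        refine ContMDiffAt.contMDiffWithinAt ?_
        refine (contMDiffAt_metric_iff s hx).2 (ContDiffOn.contDiffAt
          (contDiffOn_bilin_of_apply fun v w y' hy' ↦ ContDiffAt.contDiffWithinAt ?_)
          ((isOpen_extChartAt_target x₀).mem_nhds ((extChartAt 𝓘(ℝ, E) x₀).map_source hx)))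
        clear hx
        obtain ⟨x, hx, rfl⟩ : ∃ x ∈ (extChartAt 𝓘(ℝ, E) x₀).source,
            extChartAt 𝓘(ℝ, E) x₀ x = y' :=
          ⟨_, (extChartAt 𝓘(ℝ, E) x₀).map_target hy', (extChartAt 𝓘(ℝ, E) x₀).right_inv hy'⟩
        have h1 := hτ.contDiffAt hx
        have h2 := hZ.contDiffAt hx
        have h3 := (contMDiffAt_iff_comp_symm hx).1 (hf.contMDiffAt (x := x))
        have h4 : ContDiffAt ℝ ∞ (fun y ↦
            euclideanForm E (v - oneFormInChart τ x₀ y v • vectorFieldInChart Z x₀ y)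
              (w - oneFormInChart τ x₀ y w • vectorFieldInChart Z x₀ y)
            + oneFormInChart τ x₀ y v * (f ((extChartAt 𝓘(ℝ, E) x₀).symm y) *
              oneFormInChart τ x₀ y w)) (extChartAt 𝓘(ℝ, E) x₀ x) := by
          have h5 (u : E) : ContDiffAt ℝ ∞ (fun y ↦ oneFormInChart τ x₀ y u)
              (extChartAt 𝓘(ℝ, E) x₀ x) := h1.clm_apply contDiffAt_const
          have h6 (u : E) : ContDiffAt ℝ ∞
              (fun y ↦ u - oneFormInChart τ x₀ y u • vectorFieldInChart Z x₀ y)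
              (extChartAt 𝓘(ℝ, E) x₀ x) := contDiffAt_const.sub ((h5 u).smul h2)
          exact (ContDiffAt.euclideanForm_apply (h6 v) (h6 w)).add
            ((h5 v).mul (h3.mul (h5 w)))
        refine h4.congr_of_eventuallyEq ?_
        filter_upwards [(isOpen_extChartAt_target x₀).mem_nhds
          ((extChartAt 𝓘(ℝ, E) x₀).map_source hx)] with y hy
        have hA (u : E) : A ((extChartAt 𝓘(ℝ, E) x₀).symm y)
            (mfderiv 𝓘(ℝ, E) 𝓘(ℝ, E) (extChartAt 𝓘(ℝ, E) x₀).symm y u -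
              oneFormInChart τ x₀ y u • Z ((extChartAt 𝓘(ℝ, E) x₀).symm y)) =
            u - oneFormInChart τ x₀ y u • vectorFieldInChart Z x₀ y := by
          rw [map_sub, map_smul, vectorFieldInChart_eq Z hy]
          exact congrArg (fun r : E ↦ r - _) (mfderiv_extChartAt_mfderiv_symm hy u)
        rw [← hA, ← hA]
        rfl
      · intro x hx
        have hA (v : TangentSpace 𝓘(ℝ, E) x) (hv : v ≠ 0) : A x v ≠ 0 := by
          intro h0
          apply hv
          rw [← mfderiv_extChartAt_symm_mfderiv hx v]
          exact (congrArg (mfderiv 𝓘(ℝ, E) 𝓘(ℝ, E) (extChartAt 𝓘(ℝ, E) x₀).symm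
            (extChartAt 𝓘(ℝ, E) x₀ x)) h0).trans (map_zero _)
        refine ⟨fun v w ↦ ?_, fun v hv ↦ ?_, fun v ↦ ?_⟩
        · rw [hs, hs, euclideanForm_symm]
          ring
        · rw [hs]
          by_cases h0 : τ x v = 0
          · rw [h0, zero_smul, sub_zero, zero_mul, add_zero]
            exact euclideanForm_pos (hA v hv)
          · have h1 := euclideanForm_nonneg (A x (v - τ x v • Z x))
            have h2 : 0 < τ x v * (f x * τ x v) := by
              have := mul_pos (hf0 x) (mul_self_pos.2 h0)
              linarith
            linarith
        · rw [hs, hτZ, one_smul, sub_self, map_zero, map_zero, zero_apply, one_mul, zero_add])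
  exact ⟨{ inner := fun x ↦ s x
           symm := fun x ↦ (hs x).1
           pos := fun x ↦ (hs x).2.1
           isVonNBounded := fun x ↦ isVonNBounded_of_pos (E := E) (s x) (hs x).2.1
           contMDiff := s.contMDiff }, fun x ↦ (hs x).2.2⟩

end

section

section Calculus

variable {E : Type*} [NormedAddCommGroup E] [NormedSpace ℝ E]

/-- The second derivative of a curve whose velocity is `m X` with `m` stationary. -/
lemma deriv_deriv_eq_of_deriv_eq_smul {γ : ℝ → E} {m : ℝ → ℝ} {X : E → E} {t : ℝ}
    (hγ : DifferentiableAt ℝ γ t) (hm : HasDerivAt m 0 t) (hX : DifferentiableAt ℝ X (γ t))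
    (h : deriv γ =ᶠ[𝓝 t] fun s ↦ m s • X (γ s)) :
    deriv (deriv γ) t = m t ^ 2 • fderiv ℝ X (γ t) (X (γ t)) := by
  have h1 : HasDerivAt (fun s ↦ X (γ s)) (fderiv ℝ X (γ t) (deriv γ t)) t :=
    hX.hasFDerivAt.comp_hasDerivAt t hγ.hasDerivAt
  have h2 := (hm.smul h1).deriv
  rw [h.deriv_eq]
  refine h2.trans ?_
  rw [h.self_of_nhds, zero_smul, add_zero, map_smul, smul_smul, sq]

lemma hasFDerivAt_sq_smul_const {b : ℝ → ℝ} {y : ℝ} (hb : DifferentiableAt ℝ b y) (B : E) :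
    HasFDerivAt (fun z ↦ b z ^ 2 • B)
      (ContinuousLinearMap.toSpanSingleton ℝ ((2 * b y * deriv b y) • B)) y := by
  have h1 : HasDerivAt (fun z ↦ b z ^ 2) (2 * b y * deriv b y) y := by
    simpa using hb.hasDerivAt.fun_pow 2
  exact (h1.smul_const B).hasFDerivAt

set_option synthInstance.maxHeartbeats 400000 in
/-- The geodesic equation of the metric `b² dy²` on the line. -/
lemma geodesic_equation_line {G : ℝ → ℝ →L[ℝ] ℝ →L[ℝ] ℝ} {b : ℝ → ℝ} {y : ℝ}
    (hG : ∀ᶠ z in 𝓝 y, G z 1 1 = b z ^ 2) (hb : DifferentiableAt ℝ b y) (u s w : ℝ) :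
    G y u w + (fderiv ℝ G y s s w + fderiv ℝ G y s s w - fderiv ℝ G y w s s) / 2 =
      w * b y * (b y * u + deriv b y * s ^ 2) := by
  have hG1 (z u w : ℝ) : G z u w = u * w * G z 1 1 := by
    have h1 : G z u w = G z (u • 1) (w • 1) := by simp
    rw [h1, map_smul, map_smul, smul_apply, smul_eq_mul, smul_eq_mul]
    ring
  have hG2 : G =ᶠ[𝓝 y] fun z ↦ b z ^ 2 • ContinuousLinearMap.mul ℝ ℝ := by
    filter_upwards [hG] with z hz
    ext
    simp [hz]
  have hd := (hasFDerivAt_sq_smul_const (E := ℝ →L[ℝ] ℝ →L[ℝ] ℝ) hb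
    (ContinuousLinearMap.mul ℝ ℝ)).congr_of_eventuallyEq hG2
  rw [hd.fderiv, hG1, hG.self_of_nhds]
  simp
  ring

end Calculus

variable {E : Type*} [NormedAddCommGroup E] [NormedSpace ℝ E]
  {M : Type*} [TopologicalSpace M] [ChartedSpace E M]

set_option synthInstance.maxHeartbeats 400000 in
lemma christoffel_smul_smul
    (g : Π x : M, TangentSpace 𝓘(ℝ, E) x →L[ℝ] TangentSpace 𝓘(ℝ, E) x →L[ℝ] ℝ) (x : M) (y u w : E)
    (m : ℝ) : christoffel g x y (m • u) (m • u) w = m ^ 2 * christoffel g x y u u w := by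
  unfold christoffel
  simp only [map_smul, smul_apply, smul_eq_mul]
  ring

end

section

variable {E : Type*} [NormedAddCommGroup E] [NormedSpace ℝ E]
  {M : Type*} [TopologicalSpace M] [ChartedSpace E M] 

section

variable {N : Type*} [TopologicalSpace N] [ChartedSpace ℝ N]
  {τ : Π x : M, TangentSpace 𝓘(ℝ, E) x →L[ℝ] ℝ} {Z : Π x : M, TangentSpace 𝓘(ℝ, E) x} {ι : N → M}

lemma IsIntegralManifold.mfderiv_eq (hι : IsIntegralManifold Z ι) (hτZ : ∀ x, τ x (Z x) = 1)
    (q : N) (u : TangentSpace 𝓘(ℝ, ℝ) q) :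
    mfderiv 𝓘(ℝ, ℝ) 𝓘(ℝ, E) ι q u =
      τ (ι q) (mfderiv 𝓘(ℝ, ℝ) 𝓘(ℝ, E) ι q u) • Z (ι q) := by
  have h1 : mfderiv 𝓘(ℝ, ℝ) 𝓘(ℝ, E) ι q u ∈ Submodule.span ℝ {Z (ι q)} := by
    rw [← hι.2 q]
    exact LinearMap.mem_range_self _ u
  obtain ⟨k, hk⟩ := Submodule.mem_span_singleton.1 h1
  rw [← hk, map_smul, hτZ, smul_eq_mul, mul_one]

end

variable [IsManifold 𝓘(ℝ, E) ∞ M]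

lemma oneFormInChart_mfderiv (α : Π x : M, TangentSpace 𝓘(ℝ, E) x →L[ℝ] ℝ) {x₀ x : M}
    (hx : x ∈ (extChartAt 𝓘(ℝ, E) x₀).source) (v : TangentSpace 𝓘(ℝ, E) x) :
    oneFormInChart α x₀ (extChartAt 𝓘(ℝ, E) x₀ x)
      (mfderiv 𝓘(ℝ, E) 𝓘(ℝ, E) (extChartAt 𝓘(ℝ, E) x₀) x v) = α x v := by
  have h2 := congrArg (α x) (mfderiv_extChartAt_symm_mfderiv hx v)
  refine Eq.trans ?_ h2
  unfold oneFormInChart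
  rw [(extChartAt 𝓘(ℝ, E) x₀).left_inv hx]
  rfl

lemma IsSmoothVectorField.smul {u : M → ℝ} (hu : ContMDiff 𝓘(ℝ, E) 𝓘(ℝ, ℝ) ∞ u)
    {X : Π x : M, TangentSpace 𝓘(ℝ, E) x} (hX : IsSmoothVectorField X) :
    IsSmoothVectorField (fun p ↦ u p • X p) := by
  intro x _
  refine ContMDiffAt.contMDiffWithinAt ?_
  refine (contMDiffAt_vectorField_iff _ (mem_extChartAt_source x)).2 ?_
  refine (((contMDiffAt_iff_comp_symm (mem_extChartAt_source x)).1 hu.contMDiffAt).smul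
    (hX.contDiffAt (mem_extChartAt_source x))).congr_of_eventuallyEq ?_
  filter_upwards [eventually_mem_target x] with y hy
  refine (vectorFieldInChart_eq _ hy).trans ((map_smul _ _ _).trans ?_)
  exact congrArg (fun r : E ↦ u ((extChartAt 𝓘(ℝ, E) x).symm y) • r)
    (vectorFieldInChart_eq X hy).symm

section IntegralManifold

variable {N : Type*} [TopologicalSpace N] [ChartedSpace ℝ N] [IsManifold 𝓘(ℝ, ℝ) ∞ N]
  {τ : Π x : M, TangentSpace 𝓘(ℝ, E) x →L[ℝ] ℝ} {Z : Π x : M, TangentSpace 𝓘(ℝ, E) x} {ι : N → M}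

/-- In charts, an integral manifold of `Z` is a curve with velocity `b X`, where `X = e^{-h} Z` is
the unit vector field, and its induced metric is `b² dy²`. -/
lemma IsIntegralManifold.exists_speed (hι : IsIntegralManifold Z ι) (hτ : IsSmoothOneForm τ)
    (hτZ : ∀ x, τ x (Z x) = 1)
    {g : Π x : M, TangentSpace 𝓘(ℝ, E) x →L[ℝ] TangentSpace 𝓘(ℝ, E) x →L[ℝ] ℝ}
    {h : M → ℝ} (hh : ContMDiff 𝓘(ℝ, E) 𝓘(ℝ, ℝ) ∞ h)
    (hgZ : ∀ x v, g x (Z x) v = Real.exp (2 * h x) * τ x v) (p : N) :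
    ∃ b : ℝ → ℝ, DifferentiableAt ℝ b (extChartAt 𝓘(ℝ, ℝ) p p) ∧
      b (extChartAt 𝓘(ℝ, ℝ) p p) ≠ 0 ∧
      (∀ᶠ y in 𝓝 (extChartAt 𝓘(ℝ, ℝ) p p),
        HasDerivAt (fun y ↦ extChartAt 𝓘(ℝ, E) (ι p) (ι ((extChartAt 𝓘(ℝ, ℝ) p).symm y)))
          (b y • vectorFieldInChart (fun x ↦ Real.exp (-h x) • Z x) (ι p)
            (extChartAt 𝓘(ℝ, E) (ι p) (ι ((extChartAt 𝓘(ℝ, ℝ) p).symm y)))) y) ∧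
      ∀ᶠ y in 𝓝 (extChartAt 𝓘(ℝ, ℝ) p p),
        metricInChart (E := ℝ) (pullbackMetric (F := ℝ) g ι) p y 1 1 = b y ^ 2 := by
  set ψ := extChartAt 𝓘(ℝ, ℝ) p with hψ
  set φ := extChartAt 𝓘(ℝ, E) (ι p) with hφ
  set y₀ := ψ p with hy₀
  let L (y : ℝ) : ℝ →L[ℝ] E := ContinuousLinearMap.comp (M₂ := ℝ)
    (mfderiv 𝓘(ℝ, ℝ) 𝓘(ℝ, E) ι (ψ.symm y)) (mfderiv 𝓘(ℝ, ℝ) 𝓘(ℝ, ℝ) ψ.symm y)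
  let V (y : ℝ) : TangentSpace 𝓘(ℝ, E) (ι (ψ.symm y)) :=
    mfderiv 𝓘(ℝ, ℝ) 𝓘(ℝ, E) ι (ψ.symm y) (mfderiv 𝓘(ℝ, ℝ) 𝓘(ℝ, ℝ) ψ.symm y (1 : ℝ))
  have hV (y : ℝ) : V y = τ _ (V y) • Z (ι (ψ.symm y)) := hι.mfderiv_eq hτZ _ _
  let b (y : ℝ) : ℝ := Real.exp (h (ι (ψ.symm y))) * τ _ (V y)
  have hy₀t : y₀ ∈ ψ.target := mem_extChartAt_target p
  have hpsi0 : ψ.symm y₀ = p := extChartAt_to_inv p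
  have hev : ∀ᶠ y in 𝓝 y₀, y ∈ ψ.target ∧ ι (ψ.symm y) ∈ φ.source := by
    refine (eventually_mem_target p).and ?_
    have h1 : ContinuousAt (fun y ↦ ι (ψ.symm y)) y₀ :=
      hι.1.continuous.continuousAt.comp (contMDiffAt_extChartAt_symm hy₀t).continuousAt
    refine h1.eventually_mem ?_
    rw [hpsi0]
    exact extChartAt_source_mem_nhds (ι p)
  have hderiv : ∀ y, y ∈ ψ.target → ι (ψ.symm y) ∈ φ.source →
      HasDerivAt (fun y ↦ φ (ι (ψ.symm y)))
        (mfderiv 𝓘(ℝ, E) 𝓘(ℝ, E) φ (ι (ψ.symm y)) (V y) : E) y := by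
    intro y hy hyφ
    have h1 := ((contMDiffAt_extChartAt_of_mem hyφ).mdifferentiableAt (by simp)).hasMFDerivAt.comp
      (ψ.symm y) (hι.1.contMDiffAt.mdifferentiableAt (by simp)).hasMFDerivAt
    have h2 := h1.comp y
      ((contMDiffAt_extChartAt_symm hy).mdifferentiableAt (by simp)).hasMFDerivAt
    obtain ⟨A, hA, hA1⟩ : ∃ A : ℝ →L[ℝ] E, HasFDerivAt (fun y ↦ φ (ι (ψ.symm y))) A y ∧
        A 1 = mfderiv 𝓘(ℝ, E) 𝓘(ℝ, E) φ (ι (ψ.symm y)) (V y) := ⟨_, h2.hasFDerivAt, rfl⟩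
    exact hA1 ▸ hA.hasDerivAt
  have hsmooth : ContDiffAt ℝ ∞ (fun y ↦ φ (ι (ψ.symm y))) y₀ := by
    have h1 : ContMDiffAt 𝓘(ℝ, ℝ) 𝓘(ℝ, E) ∞ (fun q ↦ φ (ι q)) p :=
      (contMDiffAt_extChartAt (x := ι p)).comp p hι.1.contMDiffAt
    exact (contMDiffAt_iff_comp_symm (mem_extChartAt_source p)).1 h1
  refine ⟨b, ?_, ?_, ?_, ?_⟩
  · have hd2 : DifferentiableAt ℝ (deriv fun y ↦ φ (ι (ψ.symm y))) y₀ := by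
      have h1 := (hsmooth.fderiv_right (m := ∞) (by simp)).differentiableAt (by simp)
      exact h1.clm_apply (differentiableAt_const (1 : ℝ))
    have hτ1 : DifferentiableAt ℝ (oneFormInChart τ (ι p)) (φ (ι (ψ.symm y₀))) := by
      rw [hpsi0]
      exact (hτ.contDiffAt (mem_extChartAt_source (ι p))).differentiableAt (by simp)
    have hτ2 : DifferentiableAt ℝ (fun y ↦ oneFormInChart τ (ι p) (φ (ι (ψ.symm y)))) y₀ :=
      hτ1.comp y₀ (f := fun y ↦ φ (ι (ψ.symm y))) (hsmooth.differentiableAt (by simp))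
    have hh1 : DifferentiableAt ℝ (fun y ↦ h (ι (ψ.symm y))) y₀ :=
      ((contMDiffAt_iff_comp_symm (mem_extChartAt_source p)).1
        ((hh.comp hι.1).contMDiffAt (x := p))).differentiableAt (by simp)
    refine (hh1.exp.mul (hτ2.clm_apply hd2)).congr_of_eventuallyEq ?_
    filter_upwards [hev] with y hy
    rw [Pi.mul_apply, (hderiv y hy.1 hy.2).deriv, oneFormInChart_mfderiv τ hy.2]
  · refine mul_ne_zero (Real.exp_ne_zero _) fun h0 ↦ ?_
    have hZ : Z (ι (ψ.symm y₀)) ∈ LinearMap.range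
        (mfderiv 𝓘(ℝ, ℝ) 𝓘(ℝ, E) ι (ψ.symm y₀)).toLinearMap := by
      rw [hι.2]
      exact Submodule.mem_span_singleton_self _
    obtain ⟨u, hu⟩ := hZ
    have hu1 : (mfderiv 𝓘(ℝ, ℝ) 𝓘(ℝ, ℝ) ψ.symm y₀ : ℝ →L[ℝ] _)
        (mfderiv 𝓘(ℝ, ℝ) 𝓘(ℝ, ℝ) ψ (ψ.symm y₀) u) = u := by
      have h1 := mfderiv_extChartAt_symm_mfderiv (ψ.map_target hy₀t) u
      rwa [ψ.right_inv hy₀t] at h1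
    have h3 : L y₀ 1 = (0 : E) := (hV y₀).trans ((congrArg (fun r : ℝ ↦ r • Z (ι (ψ.symm y₀)))
      h0).trans (zero_smul ℝ _))
    have h2 (r : ℝ) : L y₀ r = 0 := by
      rw [← mul_one r, ← smul_eq_mul, map_smul, h3, smul_zero]
    have h4 : Z (ι (ψ.symm y₀)) = 0 := hu.symm.trans
      ((congrArg (mfderiv 𝓘(ℝ, ℝ) 𝓘(ℝ, E) ι (ψ.symm y₀)) hu1.symm).trans (h2 _))
    have h5 := hτZ (ι (ψ.symm y₀))
    rw [h4, map_zero] at h5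
    exact zero_ne_one h5
  · filter_upwards [hev] with y hy
    refine (hderiv y hy.1 hy.2).congr_deriv (Eq.symm ?_)
    refine (congrArg (fun r : E ↦ b y • r) (vectorFieldInChart_extChartAt _ hy.2)).trans ?_
    refine (map_smul (mfderiv 𝓘(ℝ, E) 𝓘(ℝ, E) φ (ι (ψ.symm y))) (b y) _).symm.trans ?_
    refine congrArg (mfderiv 𝓘(ℝ, E) 𝓘(ℝ, E) φ (ι (ψ.symm y))) ?_
    refine Eq.trans ?_ (hV y).symm
    rw [smul_smul]
    congr 1
    change Real.exp _ * _ * _ = _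
    rw [mul_right_comm, ← Real.exp_add, add_neg_cancel, Real.exp_zero, one_mul]
  · filter_upwards [hev] with y hy
    change g _ (V y) (V y) = b y ^ 2
    have h1 : g _ (V y) (V y) = τ _ (V y) * g _ (Z (ι (ψ.symm y))) (V y) := by
      have h2 := congrArg (fun r ↦ g _ r (V y)) (hV y)
      refine h2.trans ?_
      rw [map_smul, smul_apply, smul_eq_mul]
    rw [h1, hgZ, two_mul, Real.exp_add]
    change _ = (Real.exp _ * _) ^ 2
    ring

end IntegralManifold

end

section

variable {E : Type*} [NormedAddCommGroup E] [NormedSpace ℝ E]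
  {M : Type*} [TopologicalSpace M] [ChartedSpace E M] [IsManifold 𝓘(ℝ, E) ∞ M]

/-- If the unit vector field `X = e^{-h} Z` has no acceleration, then the foliation tangent to `Z`
is totally geodesic. -/
lemma foliationIsTotallyGeodesic_of_loweredAcceleration_eq_zero
    {τ : Π x : M, TangentSpace 𝓘(ℝ, E) x →L[ℝ] ℝ} (hτ : IsSmoothOneForm τ)
    {Z : Π x : M, TangentSpace 𝓘(ℝ, E) x} (hZ : IsSmoothVectorField Z)
    (hτZ : ∀ x, τ x (Z x) = 1)
    {g : Π x : M, TangentSpace 𝓘(ℝ, E) x →L[ℝ] TangentSpace 𝓘(ℝ, E) x →L[ℝ] ℝ}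
    {h : M → ℝ} (hh : ContMDiff 𝓘(ℝ, E) 𝓘(ℝ, ℝ) ∞ h)
    (hgZ : ∀ x v, g x (Z x) v = Real.exp (2 * h x) * τ x v)
    (hacc : ∀ x w, loweredAcceleration g (fun p ↦ Real.exp (-h p) • Z p) x w = 0) :
    FoliationIsTotallyGeodesic g Z := by
  intro N _ _ _ _ _ _ ι hι J c hJ _ hc
  refine ⟨hι.1.comp_contMDiffOn hc.1, fun t ht w ↦ ?_⟩
  obtain ⟨b, hb, hb0, hd, hG⟩ := hι.exists_speed hτ hτZ hh hgZ (c t)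
  have hX : DifferentiableAt ℝ (vectorFieldInChart (fun p ↦ Real.exp (-h p) • Z p) (ι (c t)))
      (extChartAt 𝓘(ℝ, E) (ι (c t)) (ι (c t))) :=
    ((hZ.smul (Real.contDiff_exp.contMDiff.comp hh.neg)).contDiffAt
      (mem_extChartAt_source _)).differentiableAt (by simp)
  set X := vectorFieldInChart (fun p ↦ Real.exp (-h p) • Z p) (ι (c t))
  set σ : ℝ → ℝ := fun s ↦ extChartAt 𝓘(ℝ, ℝ) (c t) (c s) with hσ
  set γ : ℝ → E := fun s ↦ extChartAt 𝓘(ℝ, E) (ι (c t)) (ι (c s)) with hγ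
  have hct : ContMDiffAt 𝓘(ℝ, ℝ) 𝓘(ℝ, ℝ) ∞ c t := hc.1.contMDiffAt (hJ.mem_nhds ht)
  have hσ1 : ContDiffAt ℝ ∞ σ t := (contMDiffAt_extChartAt.comp t hct).contDiffAt
  have hσ2 : HasDerivAt (deriv σ) (deriv (deriv σ) t) t := by
    have h1 : DifferentiableAt ℝ (fderiv ℝ σ) t :=
      (hσ1.fderiv_right (m := ∞) (by simp)).differentiableAt (by simp)
    exact (h1.clm_apply (differentiableAt_const (1 : ℝ))).hasDerivAt
  have hγ1 : γ =ᶠ[𝓝 t] fun s ↦ extChartAt 𝓘(ℝ, E) (ι (c t))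
      (ι ((extChartAt 𝓘(ℝ, ℝ) (c t)).symm (σ s))) := by
    filter_upwards [hct.continuousAt.eventually_mem
      (extChartAt_source_mem_nhds (I := 𝓘(ℝ, ℝ)) (c t))] with s hs
    rw [hγ, hσ, (extChartAt 𝓘(ℝ, ℝ) (c t)).left_inv hs]
  have hγ' : ∀ᶠ s in 𝓝 t, HasDerivAt γ ((b (σ s) * deriv σ s) • X (γ s)) s := by
    filter_upwards [hγ1.eventually_nhds, hσ1.continuousAt.eventually hd,
      (hσ1.of_le (m := 1) (by simp)).eventually (by simp)] with s hs1 hs2 hs3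
    have h1 := (hs2.scomp s (hs3.differentiableAt (by simp)).hasDerivAt).congr_of_eventuallyEq hs1
    refine h1.congr_deriv ?_
    rw [smul_smul, mul_comm, hs1.self_of_nhds]
  have hm : HasDerivAt (fun s ↦ b (σ s) * deriv σ s) 0 t := by
    have h1 : HasDerivAt (fun s ↦ b (σ s)) (deriv b (σ t) * deriv σ t) t :=
      HasDerivAt.comp t (h₂ := b) (h := σ) hb.hasDerivAt
        (hσ1.differentiableAt (by simp)).hasDerivAt
    refine (h1.mul hσ2).congr_deriv ?_
    have h2 := hc.2 t ht 1
    unfold christoffel at h2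
    rw [geodesic_equation_line hG hb, one_mul] at h2
    have h3 := (mul_eq_zero.1 h2).resolve_left hb0
    linear_combination h3
  have hdd := deriv_deriv_eq_of_deriv_eq_smul hγ'.self_of_nhds.differentiableAt hm hX
    (hγ'.mono fun s hs ↦ hs.deriv)
  rw [hdd, hγ'.self_of_nhds.deriv, christoffel_smul_smul, map_smul, smul_apply, smul_eq_mul,
    ← mul_add]
  exact mul_eq_zero_of_right _ (hacc (ι (c t)) w)

section Calculus

/-- A solution of an autonomous smooth differential equation is smooth. -/
lemma contDiffOn_of_forall_hasDerivAt {X : E → E} {U : Set E} (hX : ContDiffOn ℝ ∞ X U)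
    {γ : ℝ → E} {J : Set ℝ} (hJ : IsOpen J) (hγU : Set.MapsTo γ J U)
    (hγ : ∀ t ∈ J, HasDerivAt γ (X (γ t)) t) : ContDiffOn ℝ ∞ γ J := by
  refine contDiffOn_infty.2 fun n ↦ ?_
  induction n with
  | zero => exact contDiffOn_zero.2 fun t ht ↦ (hγ t ht).continuousAt.continuousWithinAt
  | succ n ih =>
    refine (contDiffOn_succ_iff_deriv_of_isOpen hJ).2
      ⟨fun t ht ↦ (hγ t ht).differentiableAt.differentiableWithinAt,
        fun h ↦ absurd h (WithTop.natCast_ne_top n), ?_⟩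
    exact ((hX.of_le (by exact_mod_cast le_top)).comp ih hγU).congr fun t ht ↦ (hγ t ht).deriv

lemma exists_smooth_integral_curve [CompleteSpace E] {X : E → E} {U : Set E} (hU : IsOpen U)
    (hX : ContDiffOn ℝ ∞ X U) {y : E} (hy : y ∈ U) :
    ∃ ε > 0, ∃ γ : ℝ → E, γ 0 = y ∧ Set.MapsTo γ (Metric.ball 0 ε) U ∧
      (∀ t ∈ Metric.ball 0 ε, HasDerivAt γ (X (γ t)) t) ∧ ContDiffOn ℝ ∞ γ (Metric.ball 0 ε) := by
  obtain ⟨r, hr, ε, hε, H⟩ :=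
    ((hX.contDiffAt (hU.mem_nhds hy)).of_le (m := 1)
      (by simp)).exists_forall_mem_closedBall_exists_eq_forall_mem_Ioo_hasDerivAt (0 : ℝ)
  obtain ⟨γ, h0, hγ⟩ := H y (Metric.mem_closedBall_self hr.le)
  rw [← Real.ball_eq_Ioo] at hγ
  have hc : ContinuousAt γ 0 := (hγ 0 (Metric.mem_ball_self hε)).continuousAt
  obtain ⟨δ, hδ, hδU⟩ := Metric.mem_nhds_iff.1 (hc.preimage_mem_nhds (h0 ▸ hU.mem_nhds hy))
  have h1 : Set.MapsTo γ (Metric.ball 0 (min ε δ)) U := fun t ht ↦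
    hδU (Metric.ball_subset_ball (min_le_right _ _) ht)
  have h2 : ∀ t ∈ Metric.ball (0 : ℝ) (min ε δ), HasDerivAt γ (X (γ t)) t := fun t ht ↦
    hγ t (Metric.ball_subset_ball (min_le_left _ _) ht)
  exact ⟨min ε δ, lt_min hε hδ, γ, h0, h1, h2,
    contDiffOn_of_forall_hasDerivAt hX Metric.isOpen_ball h1 h2⟩

end Calculus

end

section

/-- A unit speed curve `c` for the metric `b² dy²` on the line satisfies the geodesic equation. -/
lemma deriv_eq_of_mul_deriv_eq_one {b c : ℝ → ℝ} {t : ℝ} (hb : DifferentiableAt ℝ b (c t))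
    (hc : DifferentiableAt ℝ c t) (hc' : DifferentiableAt ℝ (deriv c) t)
    (h : ∀ᶠ s in 𝓝 t, b (c s) * deriv c s = 1) :
    b (c t) * deriv (deriv c) t + deriv b (c t) * deriv c t ^ 2 = 0 := by
  have h1 : HasDerivAt (fun s ↦ b (c s)) (deriv b (c t) * deriv c t) t :=
    HasDerivAt.comp t (h₂ := b) (h := c) hb.hasDerivAt hc.hasDerivAt
  have h2 := (h1.mul hc'.hasDerivAt).unique
    ((hasDerivAt_const t (1 : ℝ)).congr_of_eventuallyEq h)
  linear_combination h2

variable {E : Type*} [NormedAddCommGroup E] [NormedSpace ℝ E]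
  {M : Type*} [TopologicalSpace M] [ChartedSpace E M]

/-- The velocity of a reparametrized integral curve. -/
lemma mfderiv_apply_of_integral_curve [IsManifold 𝓘(ℝ, E) ∞ M]
    (X : Π x : M, TangentSpace 𝓘(ℝ, E) x) {x : M} {γ : ℝ → E} {ρ : ℝ → ℝ} {q k : ℝ}
    (hρ : HasDerivAt ρ k q) (hγ : HasDerivAt γ (vectorFieldInChart X x (γ (ρ q))) (ρ q))
    (hγt : γ (ρ q) ∈ (extChartAt 𝓘(ℝ, E) x).target) (r : ℝ) :
    mfderiv 𝓘(ℝ, ℝ) 𝓘(ℝ, E) (fun s ↦ (extChartAt 𝓘(ℝ, E) x).symm (γ (ρ s))) q r =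
      (r * k) • X ((extChartAt 𝓘(ℝ, E) x).symm (γ (ρ q))) := by
  have h1 : HasDerivAt (fun s ↦ γ (ρ s)) (k • vectorFieldInChart X x (γ (ρ q))) q :=
    hγ.scomp q hρ
  have h2 := HasMFDerivAt.comp q (g := (extChartAt 𝓘(ℝ, E) x).symm) (f := fun s ↦ γ (ρ s))
    ((contMDiffAt_extChartAt_symm hγt).mdifferentiableAt (by simp)).hasMFDerivAt
    h1.hasFDerivAt.hasMFDerivAt
  have h3 := DFunLike.congr_fun h2.mfderiv r
  refine h3.trans ?_
  refine (congrArg (mfderiv 𝓘(ℝ, E) 𝓘(ℝ, E) (extChartAt 𝓘(ℝ, E) x).symm (γ (ρ q)))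
    (a₂ := (r * k) • vectorFieldInChart X x (γ (ρ q))) (smul_smul r k _)).trans ?_
  refine (map_smul _ _ _).trans ?_
  exact congrArg (fun v ↦ (r * k) • v) (mfderiv_symm_vectorFieldInChart X hγt)

lemma metricInChart_pullbackMetric_real
    (g : Π x : M, TangentSpace 𝓘(ℝ, E) x →L[ℝ] TangentSpace 𝓘(ℝ, E) x →L[ℝ] ℝ) (ι : ℝ → M)
    (p y : ℝ) : metricInChart (E := ℝ) (pullbackMetric (F := ℝ) g ι) p y 1 1 =
      g (ι y) (mfderiv 𝓘(ℝ, ℝ) 𝓘(ℝ, E) ι y (1 : ℝ)) (mfderiv 𝓘(ℝ, ℝ) 𝓘(ℝ, E) ι y (1 : ℝ)) := by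
  unfold metricInChart
  rw [extChartAt_model_space_eq_id, PartialEquiv.refl_symm, PartialEquiv.refl_coe, mfderiv_id]
  rfl

variable [IsManifold 𝓘(ℝ, E) ∞ M] [CompleteSpace E]

/-- If the foliation tangent to the unit vector field `X` is totally geodesic, then `X` has no
acceleration. -/
lemma loweredAcceleration_eq_zero_of_foliationIsTotallyGeodesic
    {g : Π x : M, TangentSpace 𝓘(ℝ, E) x →L[ℝ] TangentSpace 𝓘(ℝ, E) x →L[ℝ] ℝ}
    {X Z : Π x : M, TangentSpace 𝓘(ℝ, E) x} (hX : IsSmoothVectorField X)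
    (hunit : ∀ x, g x (X x) (X x) = 1)
    (hXZ : ∀ x, Submodule.span ℝ {X x} = Submodule.span ℝ {Z x})
    (hg : FoliationIsTotallyGeodesic g Z) (x : M) (w : TangentSpace 𝓘(ℝ, E) x) :
    loweredAcceleration g X x w = 0 := by
  set φ := extChartAt 𝓘(ℝ, E) x with hφ
  have hXc : ContDiffOn ℝ ∞ (vectorFieldInChart X x) φ.target := fun y hy ↦ by
    have h1 := hX.contDiffAt (x₀ := x) (φ.map_target hy)
    rw [φ.right_inv hy] at h1
    exact h1.contDiffWithinAt
  obtain ⟨ε, hε, γ, hγ0, hγt, hγ, hγs⟩ := exists_smooth_integral_curve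
    (isOpen_extChartAt_target x) hXc (mem_extChartAt_target (I := 𝓘(ℝ, E)) x)
  let e := OpenPartialHomeomorph.univBall (0 : ℝ) ε
  have hes : e.source = Set.univ := OpenPartialHomeomorph.univBall_source _ _
  have het : e.target = Metric.ball 0 ε := OpenPartialHomeomorph.univBall_target _ hε
  have hemem (q : ℝ) : e q ∈ Metric.ball (0 : ℝ) ε := het ▸ e.map_source (hes ▸ Set.mem_univ q)
  have hesm : ContDiff ℝ ∞ e := OpenPartialHomeomorph.contDiff_univBall
  have hesym : ContDiffOn ℝ ∞ e.symm (Metric.ball 0 ε) :=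
    OpenPartialHomeomorph.contDiffOn_univBall_symm
  have hed (q : ℝ) : HasDerivAt e (deriv e q) q :=
    (hesm.differentiable (by simp) q).hasDerivAt
  have hed' (s : ℝ) (hs : s ∈ Metric.ball (0 : ℝ) ε) : HasDerivAt e.symm (deriv e.symm s) s :=
    ((hesym.contDiffAt (Metric.isOpen_ball.mem_nhds hs)).differentiableAt (by simp)).hasDerivAt
  have hright (s : ℝ) (hs : s ∈ Metric.ball (0 : ℝ) ε) : e (e.symm s) = s :=
    e.right_inv (het.symm ▸ hs)
  have hone (s : ℝ) (hs : s ∈ Metric.ball (0 : ℝ) ε) :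
      deriv e (e.symm s) * deriv e.symm s = 1 := by
    have h1 : HasDerivAt (fun s ↦ e (e.symm s)) _ s := (hed (e.symm s)).comp s (hed' s hs)
    refine h1.unique ((hasDerivAt_id s).congr_of_eventuallyEq ?_)
    filter_upwards [Metric.isOpen_ball.mem_nhds hs] with r hr using hright r hr
  have hne (q : ℝ) : deriv e q ≠ 0 := fun h0 ↦ by
    have h1 := hone (e q) (hemem q)
    rw [e.left_inv (hes ▸ Set.mem_univ q), h0, zero_mul] at h1
    exact zero_ne_one h1
  let ι : ℝ → M := fun q ↦ φ.symm (γ (e q))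
  have hιd (q r : ℝ) : mfderiv 𝓘(ℝ, ℝ) 𝓘(ℝ, E) ι q r = (r * deriv e q) • X (ι q) :=
    mfderiv_apply_of_integral_curve X (hed q) (hγ _ (hemem q)) (hγt (hemem q)) r
  have hιs : ContMDiff 𝓘(ℝ, ℝ) 𝓘(ℝ, E) ∞ ι := fun q ↦ by
    have h1 : ContDiffAt ℝ ∞ (fun q ↦ γ (e q)) q :=
      (hγs.contDiffAt (Metric.isOpen_ball.mem_nhds (hemem q))).comp q hesm.contDiffAt
    exact ContMDiffAt.comp q (g := φ.symm) (f := fun q ↦ γ (e q))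
      (contMDiffAt_extChartAt_symm (hγt (hemem q))) h1.contMDiffAt
  have hι : IsIntegralManifold Z ι := by
    refine ⟨hιs, fun q ↦ ?_⟩
    rw [← hXZ]
    ext v
    rw [Submodule.mem_span_singleton]
    constructor
    · rintro ⟨r, hr⟩
      exact ⟨_, (hιd q r).symm.trans hr⟩
    · rintro ⟨k, hk⟩
      refine ⟨k / deriv e q, (hιd q _).trans ?_⟩
      rw [div_mul_cancel₀ _ (hne q), hk]
  have hG (p y : ℝ) : metricInChart (E := ℝ) (pullbackMetric (F := ℝ) g ι) p y 1 1 =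
      deriv e y ^ 2 := by
    rw [metricInChart_pullbackMetric_real, hιd, map_smul, map_smul, smul_apply, hunit]
    simp only [smul_eq_mul]
    ring
  have hgeo : IsGeodesicOn (E := ℝ) (pullbackMetric (F := ℝ) g ι) e.symm (Metric.ball 0 ε) := by
    refine ⟨hesym.contMDiffOn, fun t ht w ↦ ?_⟩
    have hd : DifferentiableAt ℝ (deriv e) (e.symm t) :=
      ((contDiff_infty_iff_deriv.1 hesm).2.differentiable (by simp)) _
    have hd' : DifferentiableAt ℝ (deriv e.symm) t :=
      ((((contDiffOn_infty_iff_deriv_of_isOpen Metric.isOpen_ball).1 hesym).2.contDiffAt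
        (Metric.isOpen_ball.mem_nhds ht)).differentiableAt (by simp))
    have h1 := deriv_eq_of_mul_deriv_eq_one hd (hed' t ht).differentiableAt hd'
      (by filter_upwards [Metric.isOpen_ball.mem_nhds ht] with s hs using hone s hs)
    unfold christoffel
    rw [geodesic_equation_line (b := deriv e) (Filter.Eventually.of_forall (hG _))]
    · simp only [extChartAt_model_space_eq_id, PartialEquiv.refl_coe, id]
      exact mul_eq_zero_of_right _ h1
    · simpa only [extChartAt_model_space_eq_id, PartialEquiv.refl_coe, id] using hd
  have h0 : (0 : ℝ) ∈ Metric.ball (0 : ℝ) ε := Metric.mem_ball_self hε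
  have hι0 : ι (e.symm 0) = x := by
    change φ.symm (γ (e (e.symm 0))) = x
    rw [hright 0 h0, hγ0]
    exact extChartAt_to_inv x
  have hM := (hg ℝ ι hι _ _ Metric.isOpen_ball (Real.ball_eq_Ioo 0 ε ▸ Set.ordConnected_Ioo)
    hgeo).2 0 h0 w
  simp only [hι0, ← hφ] at hM
  have hev : (fun s ↦ φ (ι (e.symm s))) =ᶠ[𝓝 0] γ := by
    filter_upwards [Metric.isOpen_ball.mem_nhds h0] with s hs
    change φ (φ.symm (γ (e (e.symm s)))) = γ s
    rw [hright s hs, φ.right_inv (hγt hs)]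
  have hγ' : deriv γ =ᶠ[𝓝 0] fun s ↦ (1 : ℝ) • vectorFieldInChart X x (γ s) := by
    filter_upwards [Metric.isOpen_ball.mem_nhds h0] with s hs
    rw [(hγ s hs).deriv, one_smul]
  have hdd := deriv_deriv_eq_of_deriv_eq_smul (m := fun _ ↦ 1) (hγ 0 h0).differentiableAt
    (hasDerivAt_const _ _) ((hXc.contDiffAt ((isOpen_extChartAt_target x).mem_nhds
      (hγt h0))).differentiableAt (by simp)) hγ'
  have hd : deriv γ 0 = vectorFieldInChart X x (γ 0) := (hγ 0 h0).deriv
  rw [one_pow, one_smul] at hdd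
  rw [hev.deriv.deriv_eq, hdd, hev.deriv_eq, hd, hγ0] at hM
  exact hM

end

section

variable {E : Type*} [NormedAddCommGroup E] [NormedSpace ℝ E]
  {M : Type*} [TopologicalSpace M] [ChartedSpace E M] [IsManifold 𝓘(ℝ, E) ∞ M]

lemma contDiffAt_metricInChart
    (g : Bundle.ContMDiffRiemannianMetric 𝓘(ℝ, E) ∞ E (fun x : M ↦ TangentSpace 𝓘(ℝ, E) x))
    (x : M) : ContDiffAt ℝ ∞ (metricInChart g.inner x) (extChartAt 𝓘(ℝ, E) x x) :=
  (contMDiffAt_metric_iff g.inner (mem_extChartAt_source x)).1 (g.contMDiff x)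

lemma contMDiff_metric_apply_self
    (g : Bundle.ContMDiffRiemannianMetric 𝓘(ℝ, E) ∞ E (fun x : M ↦ TangentSpace 𝓘(ℝ, E) x))
    {Z : Π x : M, TangentSpace 𝓘(ℝ, E) x} (hZ : IsSmoothVectorField Z) :
    ContMDiff 𝓘(ℝ, E) 𝓘(ℝ, ℝ) ∞ (fun x ↦ g.inner x (Z x) (Z x)) := fun x ↦ by
  have hZx := hZ.contDiffAt (mem_extChartAt_source (I := 𝓘(ℝ, E)) x)
  refine (contMDiffAt_iff_comp_symm (mem_extChartAt_source x)).2 ?_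
  refine (((contDiffAt_metricInChart g x).clm_apply hZx).clm_apply hZx).congr_of_eventuallyEq ?_
  filter_upwards [eventually_mem_target x] with y hy
  rw [oneFormInChart_metric g.inner Z hy, oneFormInChart_vectorFieldInChart _ _ hy]

/-- The metrics for which the foliation tangent to `Z` is totally geodesic and orthogonal to `ker τ`
are those with `g(Z, ·) = e^{2h} τ` and `L_Z τ = dh - dh(Z) τ`. -/
lemma exists_totallyGeodesic_metric_iff [FiniteDimensional ℝ E] [T2Space M] [SigmaCompactSpace M]
    {τ : Π x : M, TangentSpace 𝓘(ℝ, E) x →L[ℝ] ℝ} (hτ : IsSmoothOneForm τ)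
    {Z : Π x : M, TangentSpace 𝓘(ℝ, E) x} (hZ : IsSmoothVectorField Z)
    (hτZ : ∀ x, τ x (Z x) = 1) :
    (∃ g : Bundle.ContMDiffRiemannianMetric 𝓘(ℝ, E) ∞ E (fun x : M ↦ TangentSpace 𝓘(ℝ, E) x),
      FoliationIsTotallyGeodesic g.inner Z ∧
      ∀ x, ∀ v ∈ kerForm τ x, ∀ w ∈ Submodule.span ℝ {Z x}, g.inner x v w = 0) ↔
    ∃ h : M → ℝ, ContMDiff 𝓘(ℝ, E) 𝓘(ℝ, ℝ) ∞ h ∧ ∀ x w,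
      lieDerivOneForm Z τ x w = diffForm h x w - diffForm h x (Z x) * τ x w := by
  have : CompleteSpace E := FiniteDimensional.complete ℝ E
  have hXs {h : M → ℝ} (hh : ContMDiff 𝓘(ℝ, E) 𝓘(ℝ, ℝ) ∞ h) :
      IsSmoothVectorField (fun p ↦ Real.exp (-h p) • Z p) :=
    hZ.smul (Real.contDiff_exp.contMDiff.comp hh.neg)
  have hacc (g : Bundle.ContMDiffRiemannianMetric 𝓘(ℝ, E) ∞ E
      (fun x : M ↦ TangentSpace 𝓘(ℝ, E) x)) {h : M → ℝ} (hh : ContMDiff 𝓘(ℝ, E) 𝓘(ℝ, ℝ) ∞ h)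
      (hgZ : ∀ x v, g.inner x (Z x) v = Real.exp (2 * h x) * τ x v) (x : M)
      (w : TangentSpace 𝓘(ℝ, E) x) := loweredAcceleration_eq hτ hZ hτZ hh hgZ
    ((contDiffAt_metricInChart g x).differentiableAt (by simp))
    (((hXs hh).contDiffAt (mem_extChartAt_source x)).differentiableAt (by simp)) (g.symm x) w
  constructor
  · rintro ⟨g, hg, horth⟩
    have hZ0 (x : M) : Z x ≠ 0 := fun h0 ↦ by simpa [h0] using hτZ x
    have hpos (x : M) : 0 < g.inner x (Z x) (Z x) := g.pos x (Z x) (hZ0 x)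
    let h : M → ℝ := fun x ↦ 1 / 2 * Real.log (g.inner x (Z x) (Z x))
    have hh : ContMDiff 𝓘(ℝ, E) 𝓘(ℝ, ℝ) ∞ h := fun x ↦
      ContMDiffAt.comp x (g := fun r ↦ 1 / 2 * Real.log r)
        (contDiffAt_const.mul (Real.contDiffAt_log.2 (hpos x).ne')).contMDiffAt
        (contMDiff_metric_apply_self g hZ x)
    have hgZ (x : M) (v : TangentSpace 𝓘(ℝ, E) x) :
        g.inner x (Z x) v = Real.exp (2 * h x) * τ x v := by
      have h1 : 2 * h x = Real.log (g.inner x (Z x) (Z x)) := by simp only [h]; ring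
      have h2 := horth x (v - τ x v • Z x) (by
        change τ x (v - τ x v • Z x) = 0
        rw [map_sub, map_smul, hτZ, smul_eq_mul, mul_one, sub_self]) (Z x)
        (Submodule.mem_span_singleton_self _)
      rw [g.symm, map_sub, map_smul, smul_eq_mul] at h2
      rw [h1, Real.exp_log (hpos x)]
      linarith
    refine ⟨h, hh, fun x w ↦ ?_⟩
    have h1 := loweredAcceleration_eq_zero_of_foliationIsTotallyGeodesic (hXs hh) (fun x ↦ ?_)
      (fun x ↦ Submodule.span_singleton_smul_eq (IsUnit.mk0 _ (Real.exp_ne_zero _)) _) hg x w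
    · rw [hacc g hh hgZ] at h1
      linarith
    · rw [map_smul, map_smul, smul_apply, hgZ, hτZ, smul_eq_mul, smul_eq_mul, mul_one,
        ← Real.exp_add, ← Real.exp_add, ← Real.exp_zero]
      congr 1
      ring
  · rintro ⟨h, hh, hL⟩
    obtain ⟨g, hg⟩ := exists_riemannianMetric_apply_eq hτ hZ hτZ
      (f := fun x ↦ Real.exp (2 * h x))
      (Real.contDiff_exp.contMDiff.comp ((contDiff_const.mul contDiff_id).contMDiff.comp hh))
      (fun x ↦ Real.exp_pos _)
    refine ⟨g, foliationIsTotallyGeodesic_of_loweredAcceleration_eq_zero hτ hZ hτZ hh hg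
      fun x w ↦ ?_, fun x v hv w hw ↦ ?_⟩
    · rw [hacc g hh hg, hL]
      ring
    · obtain ⟨k, rfl⟩ := Submodule.mem_span_singleton.1 hw
      have hv0 : τ x v = 0 := hv
      rw [map_smul, g.symm, hg, hv0, mul_zero, smul_zero]

end

end ZFoliation

end

theorem mainTheorem7
    {E : Type*} [NormedAddCommGroup E] [NormedSpace ℝ E] [FiniteDimensional ℝ E]
    {M : Type*} [TopologicalSpace M] [ChartedSpace E M] [IsManifold 𝓘(ℝ, E) ∞ M]
    [T2Space M] [SecondCountableTopology M] [SimplyConnectedSpace M]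
    (τ : Π x : M, TangentSpace 𝓘(ℝ, E) x →L[ℝ] ℝ)
    (hτ : ZFoliation.IsSmoothOneForm τ)
    (hτ0 : ∀ x, τ x ≠ 0)
    (hdτ : ∀ x, ∃ v ∈ ZFoliation.kerForm τ x, ∃ w ∈ ZFoliation.kerForm τ x,
      ZFoliation.extD τ x ![v, w] ≠ 0)
    (Z : Π x : M, TangentSpace 𝓘(ℝ, E) x)
    (hZ : ZFoliation.IsSmoothVectorField Z)
    (hτZ : ∀ x, τ x (Z x) = 1)
    (χ : Π x : M, ⋀[ℝ]^2 (TangentSpace 𝓘(ℝ, E) x))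
    (hχ : ZFoliation.IsSmoothBivectorField (ZFoliation.kerForm τ) χ)
    (hdτχ : ∀ x, ZFoliation.evalBivector (ZFoliation.extD τ x) (χ x) = -1) :
    (∃ g : Bundle.ContMDiffRiemannianMetric 𝓘(ℝ, E) ∞ E
        (fun x : M ↦ TangentSpace 𝓘(ℝ, E) x),
      ZFoliation.FoliationIsTotallyGeodesic g.inner Z ∧
      ∀ x, ∀ v ∈ ZFoliation.kerForm τ x, ∀ w ∈ Submodule.span ℝ {Z x}, g.inner x v w = 0) ↔
    ∀ x, ZFoliation.dSelector τ χ (ZFoliation.lieDerivOneForm Z τ) x = 0 := by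
  have : LocallyCompactSpace M := ChartedSpace.locallyCompactSpace E M
  rw [ZFoliation.dSelector_lieDerivOneForm_eq_zero_iff hτ hZ hτZ hχ hdτχ]
  exact ZFoliation.exists_totallyGeodesic_metric_iff hτ hZ hτZ
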